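/- Let $Z=\mathbb R^d\times\{0,1\}$ and let $P$ be a probability distribution of $(X,Y)$ on $Z$, with marginal $P_X$ of $X$ and regression function $\eta(x)=P(Y=1\mid X=x)$. Put $R(f)=P(Y\ne f(X))$ for Borel $f:\mathbb R^d\to\{0,1\}$, and $f^*=\mathbf 1_{\{\eta\ge 1/2\}}$. A classifier $\hat f_n$ assigns to each sample $z\in Z^n$ a Borel function $\hat f_n(z):\mathbb R^d\to\{0,1\}$, with $(z,x)\mapsto \hat f_n(z)(x)$ measurable; $\mathbb E R(\hat f_n)$ is its expected error when the sample has law $P^{\otimes n}$. Let $\lambda$ be Lebesgue measure and $B(x,r)$ the closed Euclidean ball. A Lebesgue measurable set $A\subset\mathbb R^d$ is $(c_0,r_0)$-regular if $\lambda(A\cap B(x,r))\ge c_0\lambda(B(x,r))$ for all $0<r\le r_0$ and $x\in A$. The Hölder class $\Sigma(\beta,L,\mathbb R^d)$ consists of the functions $g:\mathbb R^d\to\mathbb R$ that are $\ell$ times continuously differentiable, where $\ell$ is the largest integer strictly less than $\beta$, and satisfy $|g(x')-g_x(x')|\le L\|x-x'\|^\beta$ for all $x,x'$, where $g_x$ is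 the Taylor polynomial of $g$ of degree $\ell$ at $x$. For $\alpha,\beta,L,C_0,c_0,r_0>0$, $0<\mu_{\min}<\mu_{\max}<\infty$ and a compact $\mathcal C\subset\mathbb R^d$, let $\mathcal P_\Sigma$ be the class of all $P$ such that (i) $P_X(0<|\eta(X)-1/2|\le t)\le C_0t^\alpha$ for all $t>0$; (ii) $\eta$ has a version with values in $[0,1]$ that belongs to $\Sigma(\beta,L,\mathbb R^d)$; (iii) there is a compact $(c_0,r_0)$-regular set $A\subseteq\mathcal C$ such that $P_X$ has a Lebesgue density $\mu$ with $\mu_{\min}\le\mu\le\mu_{\max}$ on $A$ and $\mu=0$ off $A$. **Theorem.** Let $d\ge1$ be an integer and let $L,\beta,\alpha>0$ with $\alpha\beta\le d$. Let $c_0,r_0>0$, $0<\mu_{\min}<\mu_{\max}<\infty$, and let $\mathcal C\subset\mathbb R^d$ be compact. Assume that these parameters are non-degenerate: $\mathcal C$ contains a compact set $A$ with non-empty interior that is $(c_1,r_0)$-regular for some $c_1>c_0$ and satisfies $\mu_{\min}\lambda(A)\le1<\mu_{\max}\lambda(A)$. Let $C_0>0$ be arbitrary if $\alpha\beta<d$,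 and let $C_0$ exceed a threshold $C_*\ge 0$ depending only on $d,L,\beta,\alpha,c_0,r_0,\mu_{\min},\mu_{\max},\mathcal C$ if $\alpha\beta=d$. Then there is a constant $C>0$ such that for every $n\ge1$ and every classifier $\hat f_n$, $$\sup_{P\in\mathcal P_\Sigma}\big\{\mathbb E R(\hat f_n)-R(f^*)\big\}\ \ge\ C\,n^{-\frac{\beta(1+\alpha)}{2\beta+d}} .$$ -/

import Mathlib

open MeasureTheory ProbabilityTheory

noncomputable section

namespace FastRates

/-- The feature space `ℝ^d` with its Euclidean norm and Lebesgue measure. -/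
abbrev Feature (d : ℕ) : Type := EuclideanSpace ℝ (Fin d)

/-- The space `ℝ^d × {0,1}` of labelled observations; `true` is the label `1`. -/
abbrev Obs (d : ℕ) : Type := Feature d × Bool

/-- The largest integer strictly less than `β` (for `β > 0`). -/
def strictFloor (β : ℝ) : ℕ := ⌈β⌉₊ - 1

/-- The Taylor polynomial of degree `l` of `g` at `x`, evaluated at `x'`. The term of order `k`,
`(1 / k!) * D^k g(x)[x' - x, …, x' - x]`, is the sum of `(x' - x)^s / s! * D^s g(x)` over all
multi-indices `s` with `|s| = k`. -/
def taylorPoly {d : ℕ} (l : ℕ) (g : Feature d → ℝ) (x x' : Feature d) : ℝ :=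
  ∑ k ∈ Finset.range (l + 1),
    ((k.factorial : ℝ))⁻¹ * iteratedFDeriv ℝ k g x (fun _ => x' - x)

/-- The Hölder class `Σ(β, L, ℝ^d)`. -/
def holderClass (d : ℕ) (β L : ℝ) : Set (Feature d → ℝ) :=
  {g | ContDiff ℝ (strictFloor β : ℕ) g ∧
    ∀ x x' : Feature d, |g x' - taylorPoly (strictFloor β) g x x'| ≤ L * ‖x - x'‖ ^ β}

/-- `(c₀, r₀)`-regular sets. -/
def IsRegularSet {d : ℕ} (c₀ r₀ : ℝ) (A : Set (Feature d)) : Prop :=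
  NullMeasurableSet A volume ∧
    ∀ r : ℝ, 0 < r → r ≤ r₀ → ∀ x ∈ A,
      c₀ * volume.real (Metric.closedBall x r) ≤ volume.real (A ∩ Metric.closedBall x r)

/-- The strong density assumption on a distribution `Q` on `ℝ^d`. -/
def StrongDensity {d : ℕ} (c₀ r₀ μmin μmax : ℝ) (K : Set (Feature d))
    (Q : Measure (Feature d)) : Prop :=
  ∃ A : Set (Feature d), IsCompact A ∧ A ⊆ K ∧ IsRegularSet c₀ r₀ A ∧
    ∃ μ : Feature d → ℝ, Measurable μ ∧
      Q = volume.withDensity (fun x => ENNReal.ofReal (μ x)) ∧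
      (∀ x ∈ A, μmin ≤ μ x ∧ μ x ≤ μmax) ∧ (∀ x, x ∉ A → μ x = 0)

/-- The regression function `η(x) = P(Y = 1 | X = x)`, through a regular conditional
probability; it is determined up to `P_X`-null sets. -/
def regression {d : ℕ} (P : Measure (Obs d)) [IsFiniteMeasure P] (x : Feature d) : ℝ :=
  (P.condKernel x).real {true}

/-- The margin assumption with constants `C₀` and `α`. -/
def Margin {d : ℕ} (C₀ α : ℝ) (P : Measure (Obs d)) [IsFiniteMeasure P] : Prop :=
  ∀ t : ℝ, 0 < t →
    P.fst.real {x | 0 < |regression P x - 1 / 2| ∧ |regression P x - 1 / 2| ≤ t} ≤ C₀ * t ^ α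

/-- The class `P_Σ` of joint distributions of `(X, Y)`. As the regression function is determined
only `P_X`-almost everywhere, its smoothness means that it has a version with values in `[0, 1]`
that lies in the Hölder class on all of `ℝ^d`. -/
def classPSigma (d : ℕ) (α β L C₀ c₀ r₀ μmin μmax : ℝ) (K : Set (Feature d)) :
    Set (ProbabilityMeasure (Obs d)) :=
  {P | Margin C₀ α (P : Measure (Obs d)) ∧
    (∃ η : Feature d → ℝ, (∀ x, 0 ≤ η x ∧ η x ≤ 1) ∧
      η =ᵐ[(P : Measure (Obs d)).fst] regression (P : Measure (Obs d)) ∧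
      η ∈ holderClass d β L) ∧
    StrongDensity c₀ r₀ μmin μmax K (P : Measure (Obs d)).fst}

/-- The misclassification error `R(f) = P(Y ≠ f(X))`. -/
def risk {d : ℕ} (P : Measure (Obs d)) (f : Feature d → Bool) : ℝ :=
  P.real {z | z.2 ≠ f z.1}

/-- The Bayes decision rule `f*`, the indicator of `η ≥ 1/2`. -/
def bayesRule {d : ℕ} (P : Measure (Obs d)) [IsFiniteMeasure P] (x : Feature d) : Bool :=
  open Classical in decide (1 / 2 ≤ regression P x)

/-- A classifier based on a sample of size `n`: a decision rule depending on the sample, jointly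
measurable in the sample and the argument. -/
def IsClassifier {d n : ℕ} (f : (Fin n → Obs d) → Feature d → Bool) : Prop :=
  Measurable (fun p : (Fin n → Obs d) × Feature d => f p.1 p.2)

/-- The excess risk `E R(f) - R(f*)`, with the sample drawn from the `n`-fold product of `P`.
For a classifier the integrand is measurable with values in `[0, 1]`. -/
def excessRisk {d n : ℕ} (P : Measure (Obs d)) [IsFiniteMeasure P]
    (f : (Fin n → Obs d) → Feature d → Bool) : ℝ :=
  (∫ z, risk P (f z) ∂(Measure.pi fun _ : Fin n => P)) - risk P (bayesRule P)

/-- The worst-case excess risk of `f` over a class of distributions, a supremum of real numbers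
that are at most `1`. -/
def worstExcessRisk {d n : ℕ} (Ps : Set (ProbabilityMeasure (Obs d)))
    (f : (Fin n → Obs d) → Feature d → Bool) : ℝ :=
  ⨆ P : Ps, excessRisk ((P : ProbabilityMeasure (Obs d)) : Measure (Obs d)) f

/-- Non-degeneracy of the parameters of the strong density assumption: `K` contains a compact set
with non-empty interior that is regular with a constant better than `c₀` and on which some
density with values in `[μmin, μmax]`, not identically `μmax`, integrates to one. -/
def NonDegenerate {d : ℕ} (c₀ r₀ μmin μmax : ℝ) (K : Set (Feature d)) : Prop :=
  ∃ A : Set (Feature d), IsCompact A ∧ A ⊆ K ∧ (interior A).Nonempty ∧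
    (∃ c₁ : ℝ, c₀ < c₁ ∧ IsRegularSet c₁ r₀ A) ∧
    μmin * volume.real A ≤ 1 ∧ 1 < μmax * volume.real A

end FastRates

end

/-!
The minimax lower bound is proved by placing a hypercube of distributions inside the class and
bounding the average excess risk over its vertices.

All vertices share one feature marginal, uniform on `A' = A \ shells`, where `A` is the regular
set provided by non-degeneracy and the shells are thin open spherical shells of inner radius `a`
and outer radius `(1 + ε) a` around `m` well separated centres deep inside `A`. A sign pattern `σ`
gives the regression function `1/2 + b a^β ∑ i, ± φ ((x - z i) / a)` for a smooth bump `φ` which is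
`1` on the unit ball and `0` off the ball of radius `1 + ε`. The whole transition of `φ` takes
place over the shells, which carry no mass; on the support `η - 1/2` is `± b a^β` on the `m`
enclosed balls and `0` elsewhere. Hence the margin assumption only asks that the enclosed balls
have total mass at most `C₀ (b a^β)^α`, which allows `m ≍ a^(αβ - d)` bumps; when `αβ = d` this is
a single bump, which is admissible once `C₀` is large.

* Hölder smoothness: `abs_sub_taylorPoly_le` turns bounds on derivatives into a bound on Taylor
  remainders at unit scale, and `rescale_mem_holderClass` transports it to scale `a`.
* Regularity of `A'`: `isRegularSet_diff_shells`. A regularity constant of a compact set is at most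
  `1/2` (`regular_const_le_half`), so `c₀ < 1/2`. A ball much smaller than `a` meets at most one
  shell and sees either side of it as nearly a half-space, which is enough since `c₀ < 1/2`; a larger
  ball loses a proportion of volume that tends to `0` with `ε`, which is enough since `c₀ < c₁`.
* Lower bound on the hypercube: flipping the sign of one bump changes the law of `n` observations
  undetectably as long as `n a^(2β + d)` is small (`half_le_sum_errors`, through the second moment
  of the likelihood ratio). Pairing each vertex with its neighbours yields a worst-case excess risk
  of order `m · a^β · a^d` (`card_mul_le_worstExcessRisk`).

With `a ≍ n^(-1/(2β + d))` the order `m a^(β + d) ≍ a^(β (1 + α))` is the asserted rate.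
-/

namespace FastRates

/-! ### Taylor polynomials and the Hölder class -/

/-- Rescaling the argument commutes with taking Taylor polynomials. -/
theorem taylorPoly_const_add_mul_comp_smul {d : ℕ} {l : ℕ} {g : Feature d → ℝ}
    (hg : ContDiff ℝ l g) (c s a : ℝ) (x x' : Feature d) :
    taylorPoly l (fun y => c + s * g (a • y)) x x' = c + s * taylorPoly l g (a • x) (a • x') := by
  have hscale : ∀ k ≤ l, ∀ y : Feature d, iteratedFDeriv ℝ k (fun y => s * g (a • y)) x
      (fun _ => y) = s * iteratedFDeriv ℝ k g (a • x) (fun _ => a • y) := by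
    intro k hk y
    have hkl : (k : WithTop ℕ∞) ≤ l := by exact_mod_cast hk
    have hcomp := (a • ContinuousLinearMap.id ℝ (Feature d)).iteratedFDeriv_comp_right hg x hkl
    have hsm : ContDiffAt ℝ k (fun y : Feature d => g (a • y)) x :=
      ((hg.of_le hkl).comp (contDiff_const_smul a)).contDiffAt
    have h1 : iteratedFDeriv ℝ k (fun y : Feature d => s * g (a • y)) x
        = s • iteratedFDeriv ℝ k (fun y : Feature d => g (a • y)) x :=
      iteratedFDeriv_const_smul_apply (a := s) hsm
    have h2 : (g ∘ (a • ContinuousLinearMap.id ℝ (Feature d))) = fun y => g (a • y) := by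
      ext y; simp
    rw [h1, ← h2, hcomp]
    simp
  unfold taylorPoly
  rw [Finset.sum_range_succ', Finset.sum_range_succ' _ l, mul_add, Finset.mul_sum]
  simp only [Nat.factorial_zero, Nat.cast_one, inv_one, iteratedFDeriv_zero_apply, one_mul]
  rw [← add_assoc, add_comm c, add_assoc, add_assoc, add_comm c]
  congr 1
  · refine Finset.sum_congr rfl fun k hk => ?_
    have hk' : k + 1 ≤ l := Finset.mem_range.mp hk
    have hadd : iteratedFDeriv ℝ (k + 1) (fun y : Feature d => c + s * g (a • y)) x
        = iteratedFDeriv ℝ (k + 1) (fun y : Feature d => s * g (a • y)) x := by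
      have hkl : ((k + 1 : ℕ) : WithTop ℕ∞) ≤ l := by exact_mod_cast hk'
      have hsm : ContDiffAt ℝ (k + 1 : ℕ) (fun y : Feature d => s * g (a • y)) x :=
        (contDiff_const.mul ((hg.of_le hkl).comp (contDiff_const_smul a))).contDiffAt
      have hsplit := iteratedFDeriv_add_apply (contDiffAt_const (c := c)) hsm
      rw [iteratedFDeriv_const_of_ne (Nat.succ_ne_zero k), Pi.zero_apply, zero_add] at hsplit
      exact hsplit
    rw [hadd, hscale (k + 1) hk', smul_sub]
    ring

/-- A function with bounded derivatives up to order `l + 1` has Taylor remainders bounded by a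
multiple of `‖x - x'‖ ^ β` for every `β ∈ (l, l + 1]`: increments of norm at most one are handled
by the integral remainder, longer ones by bounding every term of the Taylor polynomial. -/
theorem abs_sub_taylorPoly_le {d : ℕ} {l : ℕ} {g : Feature d → ℝ} {M β : ℝ}
    (hg : ContDiff ℝ (l + 1) g) (hM : ∀ k ≤ l + 1, ∀ x, ‖iteratedFDeriv ℝ k g x‖ ≤ M)
    (hl : (l : ℝ) ≤ β) (hl' : β ≤ l + 1) (x x' : Feature d) :
    |g x' - taylorPoly l g x x'| ≤ (l + 2) * M * ‖x - x'‖ ^ β := by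
  have hM0 : 0 ≤ M := (norm_nonneg _).trans (hM 0 (Nat.zero_le _) x)
  set h := x' - x with hh
  have hnorm : ‖x - x'‖ = ‖h‖ := by rw [hh, norm_sub_rev]
  have hterm : ∀ k ≤ l + 1, ∀ y : Feature d,
      |iteratedFDeriv ℝ k g y (fun _ => h)| ≤ M * ‖h‖ ^ k := by
    intro k hk y
    calc |iteratedFDeriv ℝ k g y (fun _ => h)|
        ≤ ‖iteratedFDeriv ℝ k g y‖ * ∏ _i : Fin k, ‖h‖ :=
          (iteratedFDeriv ℝ k g y).le_opNorm _
      _ ≤ M * ‖h‖ ^ k := by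
          rw [Finset.prod_const, Finset.card_univ, Fintype.card_fin]
          exact mul_le_mul_of_nonneg_right (hM k hk y) (by positivity)
  have hfact : ∀ k : ℕ, ((k.factorial : ℝ))⁻¹ ≤ 1 := fun k =>
    inv_le_one_of_one_le₀ (by exact_mod_cast Nat.one_le_iff_ne_zero.mpr (Nat.factorial_ne_zero k))
  rw [hnorm]
  rcases le_or_gt ‖h‖ 1 with hle | hgt
  · have htaylor := map_add_eq_sum_add_integral_iteratedFDeriv (f := g) (x := x) (y := h) (n := l)
      (fun t _ => hg.contDiffAt)
    have hx' : x + h = x' := by simp [hh]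
    rw [hx'] at htaylor
    have hrem : g x' - taylorPoly l g x x' = (l.factorial : ℝ)⁻¹ •
        ∫ t in (0 : ℝ)..1, (1 - t) ^ l • iteratedFDeriv ℝ (l + 1) g (x + t • h) (fun _ => h) := by
      rw [htaylor]
      simp [taylorPoly, ← hh]
    have hint : |∫ t in (0 : ℝ)..1, (1 - t) ^ l •
        iteratedFDeriv ℝ (l + 1) g (x + t • h) (fun _ => h)| ≤ M * ‖h‖ ^ (l + 1) := by
      have := intervalIntegral.norm_integral_le_of_norm_le_const (a := (0 : ℝ)) (b := 1)
        (C := M * ‖h‖ ^ (l + 1)) (f := fun t : ℝ => (1 - t) ^ l •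
          iteratedFDeriv ℝ (l + 1) g (x + t • h) (fun _ => h)) ?_
      · simpa using this
      · intro t ht
        rw [Set.uIoc_of_le zero_le_one] at ht
        rw [norm_smul, Real.norm_eq_abs, Real.norm_eq_abs, abs_pow,
          abs_of_nonneg (by linarith [ht.2])]
        calc (1 - t) ^ l * |iteratedFDeriv ℝ (l + 1) g (x + t • h) (fun _ => h)|
            ≤ 1 * (M * ‖h‖ ^ (l + 1)) :=
              mul_le_mul (pow_le_one₀ (by linarith [ht.2]) (by linarith [ht.1]))
                (hterm _ le_rfl _) (abs_nonneg _) zero_le_one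
          _ = _ := one_mul _
    have hpow : ‖h‖ ^ (l + 1) ≤ ‖h‖ ^ β := by
      rcases (norm_nonneg h).eq_or_lt with h0 | hpos
      · rw [← h0, zero_pow (Nat.succ_ne_zero l)]
        positivity
      · rw [← Real.rpow_natCast]
        exact Real.rpow_le_rpow_of_exponent_ge hpos hle (by push_cast; exact hl')
    rw [hrem, smul_eq_mul, abs_mul, abs_of_nonneg (by positivity)]
    calc (l.factorial : ℝ)⁻¹ * _ ≤ 1 * (M * ‖h‖ ^ (l + 1)) :=
          mul_le_mul (hfact l) hint (abs_nonneg _) zero_le_one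
      _ ≤ (l + 2) * (M * ‖h‖ ^ β) := by
          gcongr
          linarith [(Nat.cast_nonneg l : (0 : ℝ) ≤ l)]
      _ = _ := by ring
  · have hpow : ∀ k ≤ l, ‖h‖ ^ k ≤ ‖h‖ ^ β := by
      intro k hk
      rw [← Real.rpow_natCast]
      exact Real.rpow_le_rpow_of_exponent_le hgt.le
        (le_trans (by exact_mod_cast hk) hl)
    have hg0 : |g x'| ≤ M * ‖h‖ ^ β := by
      have h0 := hM 0 (Nat.zero_le _) x'
      rw [norm_iteratedFDeriv_zero, Real.norm_eq_abs] at h0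
      have h1 := hpow 0 (Nat.zero_le _)
      rw [pow_zero] at h1
      nlinarith
    have hT : |taylorPoly l g x x'| ≤ (l + 1) * (M * ‖h‖ ^ β) := by
      unfold taylorPoly
      refine (Finset.abs_sum_le_sum_abs _ _).trans ?_
      have : ∀ k ∈ Finset.range (l + 1), |((k.factorial : ℝ))⁻¹ *
          iteratedFDeriv ℝ k g x (fun _ => x' - x)| ≤ M * ‖h‖ ^ β := by
        intro k hk
        have hkl : k ≤ l := Nat.lt_succ_iff.mp (Finset.mem_range.mp hk)
        rw [abs_mul, abs_of_nonneg (by positivity)]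
        calc _ ≤ 1 * (M * ‖h‖ ^ k) :=
              mul_le_mul (hfact k) (hterm k (by omega) x) (abs_nonneg _) zero_le_one
          _ ≤ M * ‖h‖ ^ β := by
              rw [one_mul]; exact mul_le_mul_of_nonneg_left (hpow k hkl) hM0
      refine (Finset.sum_le_sum this).trans ?_
      simp
    calc |g x' - taylorPoly l g x x'| ≤ |g x'| + |taylorPoly l g x x'| := abs_sub _ _
      _ ≤ (l + 2) * M * ‖h‖ ^ β := by linarith

theorem strictFloor_le {β : ℝ} (hβ : 0 < β) :
    (strictFloor β : ℝ) ≤ β ∧ β ≤ strictFloor β + 1 := by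
  have h1 : 1 ≤ ⌈β⌉₊ := Nat.one_le_iff_ne_zero.mpr (Nat.ceil_pos.mpr hβ).ne'
  have h2 : ((⌈β⌉₊ - 1 : ℕ) : ℝ) = (⌈β⌉₊ : ℝ) - 1 := by push_cast [h1]; ring
  unfold strictFloor
  rw [h2]
  exact ⟨by linarith [Nat.ceil_lt_add_one hβ.le], by linarith [Nat.le_ceil β]⟩

/-- The rescaling `x ↦ 1/2 + b a^β g(x / a)` preserves the Hölder seminorm of `g` up to the
factor `b`. -/
theorem rescale_mem_holderClass {d : ℕ} {β L M a b : ℝ} (hβ : 0 < β) (ha : 0 < a) (hb : 0 ≤ b)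
    {g : Feature d → ℝ} (hg : ContDiff ℝ (strictFloor β + 1) g)
    (hM : ∀ k ≤ strictFloor β + 1, ∀ x, ‖iteratedFDeriv ℝ k g x‖ ≤ M)
    (hbL : b * ((strictFloor β + 2) * M) ≤ L) :
    (fun x => 1 / 2 + b * a ^ β * g (a⁻¹ • x)) ∈ holderClass d β L := by
  have hg' : ContDiff ℝ (strictFloor β : ℕ) g := hg.of_le (by
    exact_mod_cast Nat.le_succ _)
  refine ⟨contDiff_const.add (contDiff_const.mul (hg'.comp (contDiff_const_smul _))),
    fun x x' => ?_⟩
  rw [taylorPoly_const_add_mul_comp_smul hg']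
  have hkey := abs_sub_taylorPoly_le hg hM (strictFloor_le hβ).1 (strictFloor_le hβ).2
    (a⁻¹ • x) (a⁻¹ • x')
  have hnorm : ‖a⁻¹ • x - a⁻¹ • x'‖ ^ β = (a ^ β)⁻¹ * ‖x - x'‖ ^ β := by
    rw [← smul_sub, norm_smul, Real.mul_rpow (norm_nonneg _) (norm_nonneg _), Real.norm_eq_abs,
      abs_of_pos (inv_pos.mpr ha), Real.inv_rpow ha.le]
  have haβ : 0 < a ^ β := Real.rpow_pos_of_pos ha β
  rw [hnorm] at hkey
  have hrw : (1 / 2 + b * a ^ β * g (a⁻¹ • x')) - (1 / 2 + b * a ^ β *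
      taylorPoly (strictFloor β) g (a⁻¹ • x) (a⁻¹ • x'))
      = b * a ^ β * (g (a⁻¹ • x') - taylorPoly (strictFloor β) g (a⁻¹ • x) (a⁻¹ • x')) := by ring
  rw [hrw, abs_mul, abs_of_nonneg (by positivity)]
  calc b * a ^ β * _ ≤ b * a ^ β * ((strictFloor β + 2) * M * ((a ^ β)⁻¹ * ‖x - x'‖ ^ β)) :=
        mul_le_mul_of_nonneg_left hkey (by positivity)
    _ = b * ((strictFloor β + 2) * M) * ‖x - x'‖ ^ β := by
        field_simp
    _ ≤ L * ‖x - x'‖ ^ β := mul_le_mul_of_nonneg_right hbL (by positivity)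

/-! ### Sums of separated bumps -/

/-- A signed sum of translates of `φ` along the family of centres `w`. -/
def bumpSum {d : ℕ} {ι : Type*} [Fintype ι] (φ : Feature d → ℝ) (w : ι → Feature d) (s : ι → ℝ)
    (x : Feature d) : ℝ :=
  ∑ i, s i * φ (x - w i)

theorem contDiff_bumpSum {d : ℕ} {ι : Type*} [Fintype ι] {φ : Feature d → ℝ} {n : WithTop ℕ∞}
    (hφ : ContDiff ℝ n φ) (w : ι → Feature d) (s : ι → ℝ) : ContDiff ℝ n (bumpSum φ w s) :=
  ContDiff.sum fun _ _ => contDiff_const.mul (hφ.comp (contDiff_id.sub contDiff_const))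

/-- If the centres are so far apart that the translated supports are disjoint, then derivative
bounds pass from the profile to the sum. -/
theorem norm_iteratedFDeriv_bumpSum_le {d : ℕ} {ι : Type*} [Fintype ι] {φ : Feature d → ℝ}
    {R M : ℝ} {k : ℕ} (hφ : ContDiff ℝ k φ) (hsupp : tsupport φ ⊆ Metric.closedBall 0 R)
    (hM : ∀ x, ‖iteratedFDeriv ℝ k φ x‖ ≤ M) {w : ι → Feature d}
    (hw : Pairwise fun i j => 2 * R < dist (w i) (w j)) {s : ι → ℝ} (hs : ∀ i, |s i| ≤ 1)
    (x : Feature d) : ‖iteratedFDeriv ℝ k (bumpSum φ w s) x‖ ≤ M := by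
  have hM0 : 0 ≤ M := (norm_nonneg _).trans (hM 0)
  have hsm : ∀ i, ContDiff ℝ k fun y => φ (y - w i) := fun i =>
    hφ.comp (contDiff_id.sub contDiff_const)
  have hsum : iteratedFDeriv ℝ k (bumpSum φ w s) x
      = ∑ i, s i • iteratedFDeriv ℝ k φ (x - w i) := by
    have h1 : bumpSum φ w s = ∑ i, fun y => s i * φ (y - w i) := by
      ext y; simp [bumpSum]
    rw [h1, iteratedFDeriv_sum_apply fun i _ => (contDiff_const.mul (hsm i)).contDiffAt]
    refine Finset.sum_congr rfl fun i _ => ?_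
    rw [← iteratedFDeriv_comp_sub]
    exact iteratedFDeriv_const_smul_apply (a := s i) (hsm i).contDiffAt
  have hzero : ∀ i, R < dist x (w i) → iteratedFDeriv ℝ k φ (x - w i) = 0 := by
    intro i hi
    by_contra hne
    have := hsupp (support_iteratedFDeriv_subset k hne)
    rw [mem_closedBall_zero_iff, ← dist_eq_norm] at this
    linarith
  rw [hsum]
  by_cases hx : ∃ i, dist x (w i) ≤ R
  · obtain ⟨i, hi⟩ := hx
    rw [Finset.sum_eq_single i]
    · rw [norm_smul, Real.norm_eq_abs]
      calc _ ≤ 1 * M := mul_le_mul (hs i) (hM _) (norm_nonneg _) zero_le_one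
        _ = M := one_mul M
    · intro j _ hji
      rw [hzero j, smul_zero]
      have h1 := hw hji
      have h2 := dist_triangle_left (w j) (w i) x
      linarith
    · simp
  · push Not at hx
    rw [Finset.sum_eq_zero fun i _ => by rw [hzero i (hx i), smul_zero], norm_zero]
    exact hM0

/-- A smooth function of compact support has bounded derivatives up to any finite order. -/
theorem exists_bound_iteratedFDeriv {d : ℕ} {φ : Feature d → ℝ} {l : ℕ}
    (hφ : ContDiff ℝ l φ) (hc : HasCompactSupport φ) :
    ∃ M : ℝ, 0 < M ∧ ∀ k ≤ l, ∀ x, ‖iteratedFDeriv ℝ k φ x‖ ≤ M := by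
  have hex : ∀ k, ∃ M : ℝ, k ≤ l → ∀ x, ‖iteratedFDeriv ℝ k φ x‖ ≤ M := by
    intro k
    by_cases hk : k ≤ l
    · obtain ⟨M, hM⟩ := (hc.iteratedFDeriv (𝕜 := ℝ) k).exists_bound_of_continuous
        (hφ.continuous_iteratedFDeriv (by exact_mod_cast hk))
      exact ⟨M, fun _ => hM⟩
    · exact ⟨0, fun h => absurd h hk⟩
  choose M hM using hex
  refine ⟨1 + ∑ k ∈ Finset.range (l + 1), |M k|, by positivity, fun k hk x => ?_⟩
  have h1 : |M k| ≤ ∑ k ∈ Finset.range (l + 1), |M k| :=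
    Finset.single_le_sum (fun i _ => abs_nonneg (M i)) (Finset.mem_range.mpr (by omega))
  linarith [hM k hk x, le_abs_self (M k)]

/-- On the unit ball around a centre the sum equals the coefficient there, because the other
centres are too far to contribute. -/
theorem bumpSum_eq_of_dist_le {d : ℕ} {ι : Type*} [Fintype ι] {φ : Feature d → ℝ} {R : ℝ}
    (hone : ∀ x, ‖x‖ ≤ 1 → φ x = 1) (hzero : ∀ x, R ≤ ‖x‖ → φ x = 0) {w : ι → Feature d}
    (hR : 1 ≤ R) (hw : Pairwise fun i j => 2 * R < dist (w i) (w j)) (s : ι → ℝ) {x : Feature d}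
    {i : ι} (hx : dist x (w i) ≤ 1) : bumpSum φ w s x = s i := by
  unfold bumpSum
  rw [Finset.sum_eq_single i]
  · rw [hone _ (by rwa [← dist_eq_norm]), mul_one]
  · intro j _ hji
    have h1 := hw hji
    have h2 := dist_triangle_left (w j) (w i) x
    rw [hzero _ (by rw [← dist_eq_norm]; linarith), mul_zero]
  · simp

theorem bumpSum_eq_zero {d : ℕ} {ι : Type*} [Fintype ι] {φ : Feature d → ℝ} {R : ℝ}
    (hzero : ∀ x, R ≤ ‖x‖ → φ x = 0) {w : ι → Feature d} (s : ι → ℝ) {x : Feature d}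
    (hx : ∀ i, R ≤ dist x (w i)) : bumpSum φ w s x = 0 :=
  Finset.sum_eq_zero fun i _ => by rw [hzero _ (by rw [← dist_eq_norm]; exact hx i), mul_zero]


/-! ### Testing two product measures -/

/-- A power of a measure with density is the power of the base measure weighted by the product of
the densities. -/
theorem pi_withDensity_ofReal {Z ι : Type*} [MeasurableSpace Z] [Fintype ι] (P : Measure Z)
    [IsFiniteMeasure P] {ρ : Z → ℝ} (hint : Integrable ρ P)
    (h0 : ∀ z, 0 ≤ ρ z) :
    Measure.pi (fun _ : ι => P.withDensity fun z => ENNReal.ofReal (ρ z))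
      = (Measure.pi fun _ : ι => P).withDensity fun z => ENNReal.ofReal (∏ i, ρ (z i)) := by
  have : IsFiniteMeasure (P.withDensity fun z => ENNReal.ofReal (ρ z)) :=
    isFiniteMeasure_withDensity_ofReal hint.2
  refine (Measure.pi_eq (μ := fun _ : ι => P.withDensity fun z => ENNReal.ofReal (ρ z))
    fun s hs => ?_)
  have hprod : Integrable (fun z : ι → Z => ∏ i, ρ (z i)) (Measure.pi fun _ : ι => P) :=
    Integrable.fintype_prod (f := fun _ => ρ) fun _ => hint
  have hS : MeasurableSet (Set.univ.pi s) := MeasurableSet.univ_pi hs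
  rw [withDensity_apply _ hS, ← ofReal_integral_eq_lintegral_ofReal hprod.integrableOn
    (ae_of_all _ fun z => Finset.prod_nonneg fun i _ => h0 _)]
  have hfac : ∀ i, (P.withDensity fun z => ENNReal.ofReal (ρ z)) (s i)
      = ENNReal.ofReal (∫ z, (s i).indicator ρ z ∂P) := by
    intro i
    rw [withDensity_apply _ (hs i), integral_indicator (hs i),
      ofReal_integral_eq_lintegral_ofReal hint.integrableOn (ae_of_all _ h0)]
  simp_rw [hfac]
  rw [← ENNReal.ofReal_prod_of_nonneg fun i _ =>
    integral_nonneg fun z => Set.indicator_nonneg (fun z _ => h0 z) z,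
    ← integral_fintype_prod_eq_prod (fun i => (s i).indicator ρ), ← integral_indicator hS]
  congr 2
  ext z
  classical
  by_cases hz : z ∈ Set.univ.pi s
  · rw [Set.indicator_of_mem hz]
    exact Finset.prod_congr rfl fun i _ => (Set.indicator_of_mem (hz i trivial) _).symm
  · rw [Set.indicator_of_notMem hz]
    simp only [Set.mem_pi, Set.mem_univ, true_implies, not_forall] at hz
    obtain ⟨i, hi⟩ := hz
    exact (Finset.prod_eq_zero (Finset.mem_univ i) (Set.indicator_of_notMem hi _)).symm

/-- **Two-point bound.** If `n` times the `χ²`-divergence of `P'` from `P` is at most `1/2`, then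
no test based on `n` observations separates `P` from `P'`: the two error probabilities of a
randomized test `g` add up to at least `1/2`. With `U` the likelihood ratio of the samples, the
sum is at least `E min(1, U) ≥ E (U - U² / 4)`, and the second moment of `U` factorizes. -/
theorem half_le_sum_errors {Z : Type*} [MeasurableSpace Z] {P P' : Measure Z}
    [IsProbabilityMeasure P] {ρ : Z → ℝ} (hρ : Measurable ρ) (h0 : ∀ z, 0 ≤ ρ z) {B : ℝ}
    (hB : ∀ z, ρ z ≤ B) (hP' : P' = P.withDensity fun z => ENNReal.ofReal (ρ z))
    (h1 : ∫ z, ρ z ∂P = 1) {χ : ℝ} (hχ : ∫ z, ρ z ^ 2 ∂P ≤ 1 + χ) {n : ℕ} (hn : n * χ ≤ 1 / 2)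
    {g : (Fin n → Z) → ℝ} (hg : Measurable g) (hg0 : ∀ z, 0 ≤ g z) (hg1 : ∀ z, g z ≤ 1) :
    1 / 2 ≤ ∫ z, g z ∂(Measure.pi fun _ : Fin n => P)
      + ∫ z, (1 - g z) ∂(Measure.pi fun _ : Fin n => P') := by
  have hint : Integrable ρ P := Integrable.of_bound hρ.aestronglyMeasurable B
    (ae_of_all _ fun z => by rw [Real.norm_eq_abs, abs_of_nonneg (h0 z)]; exact hB z)
  have hint2 : Integrable (fun z => ρ z ^ 2) P :=
    Integrable.of_bound (hρ.pow_const 2).aestronglyMeasurable (B ^ 2)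
      (ae_of_all _ fun z => by
        rw [Real.norm_eq_abs, abs_of_nonneg (by positivity)]
        exact pow_le_pow_left₀ (h0 z) (hB z) 2)
  set U : (Fin n → Z) → ℝ := fun z => ∏ i, ρ (z i) with hU
  have hUmeas : Measurable U :=
    Finset.measurable_prod _ fun i _ => hρ.comp (measurable_pi_apply i)
  have hU0 : ∀ z, 0 ≤ U z := fun z => Finset.prod_nonneg fun i _ => h0 _
  have hUint : Integrable U (Measure.pi fun _ : Fin n => P) :=
    Integrable.fintype_prod (f := fun _ => ρ) fun _ => hint
  have hU2 : ∀ z : Fin n → Z, U z ^ 2 = ∏ i, ρ (z i) ^ 2 := fun z =>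
    (Finset.prod_pow _ _ _).symm
  have hU2int : Integrable (fun z => U z ^ 2) (Measure.pi fun _ : Fin n => P) := by
    simp_rw [hU2]
    exact Integrable.fintype_prod (f := fun _ z => ρ z ^ 2) fun _ => hint2
  have hUone : ∫ z, U z ∂(Measure.pi fun _ : Fin n => P) = 1 := by
    rw [hU, integral_fintype_prod_eq_pow, h1, one_pow]
  have hUtwo : ∫ z, U z ^ 2 ∂(Measure.pi fun _ : Fin n => P) ≤ 2 := by
    simp_rw [hU2]
    rw [integral_fintype_prod_eq_pow (fun z => ρ z ^ 2), Fintype.card_fin]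
    have hpos : 0 ≤ ∫ z, ρ z ^ 2 ∂P := integral_nonneg fun z => sq_nonneg _
    calc (∫ z, ρ z ^ 2 ∂P) ^ n ≤ (Real.exp χ) ^ n :=
          pow_le_pow_left₀ hpos (hχ.trans (by linarith [Real.add_one_le_exp χ])) n
      _ = Real.exp (n * χ) := (Real.exp_nat_mul χ n).symm
      _ ≤ Real.exp (1 / 2) := Real.exp_le_exp.mpr hn
      _ ≤ 2 := by
          have h2 : Real.exp (1 / 2) ^ 2 = Real.exp 1 := by
            rw [← Real.exp_nat_mul]; norm_num
          nlinarith [Real.exp_one_lt_d9, Real.exp_pos (1 / 2)]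
  have hchange : ∫ z, (1 - g z) ∂(Measure.pi fun _ : Fin n => P')
      = ∫ z, U z * (1 - g z) ∂(Measure.pi fun _ : Fin n => P) := by
    rw [hP', pi_withDensity_ofReal P hint h0,
      integral_withDensity_eq_integral_toReal_smul hUmeas.ennreal_ofReal
        (ae_of_all _ fun _ => ENNReal.ofReal_lt_top)]
    refine integral_congr_ae (ae_of_all _ fun z => ?_)
    simp only [smul_eq_mul]
    rw [ENNReal.toReal_ofReal (hU0 z)]
  have hgint : Integrable g (Measure.pi fun _ : Fin n => P) :=
    Integrable.of_bound hg.aestronglyMeasurable 1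
      (ae_of_all _ fun z => by rw [Real.norm_eq_abs, abs_of_nonneg (hg0 z)]; exact hg1 z)
  have hUg : Integrable (fun z => U z * (1 - g z)) (Measure.pi fun _ : Fin n => P) :=
    hUint.mul_bdd (c := 1) (measurable_const.sub hg).aestronglyMeasurable
      (ae_of_all _ fun z => by
        rw [Real.norm_eq_abs, abs_of_nonneg (by linarith [hg1 z])]; linarith [hg0 z])
  rw [hchange, ← integral_add hgint hUg]
  have hlow : ∫ z, (U z - U z ^ 2 / 4) ∂(Measure.pi fun _ : Fin n => P)
      ≤ ∫ z, (g z + U z * (1 - g z)) ∂(Measure.pi fun _ : Fin n => P) := by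
    refine integral_mono (hUint.sub (hU2int.div_const 4)) (hgint.add hUg) fun z => ?_
    -- the right side is a convex combination of `1` and `U`, both at least `U - U² / 4`
    have e1 : U z - U z ^ 2 / 4 ≤ 1 := by nlinarith [sq_nonneg (U z / 2 - 1)]
    have e2 : U z - U z ^ 2 / 4 ≤ U z := by nlinarith [sq_nonneg (U z)]
    have e3 := mul_le_mul_of_nonneg_left e1 (hg0 z)
    have e4 := mul_le_mul_of_nonneg_left e2 (sub_nonneg.mpr (hg1 z))
    simp only
    linarith
  rw [integral_sub hUint (hU2int.div_const 4), hUone, integral_div] at hlow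
  linarith


/-! ### Distributions with a prescribed regression function -/

/-- The conditional law of the label given the feature: Bernoulli with parameter `η x`. It is a
Markov kernel when `η` takes values in `[0, 1]`, which is assumed wherever it is used. -/
noncomputable def labelKernel {d : ℕ} (η : Feature d → ℝ) (hη : Measurable η) :
    Kernel (Feature d) Bool where
  toFun x := ENNReal.ofReal (η x) • Measure.dirac true
    + ENNReal.ofReal (1 - η x) • Measure.dirac false
  measurable' := by
    refine Measure.measurable_of_measurable_coe _ fun s _ => ?_
    simp only [Measure.coe_add, Measure.coe_smul, Pi.add_apply, Pi.smul_apply, smul_eq_mul]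
    exact (hη.ennreal_ofReal.mul_const _).add ((measurable_const.sub hη).ennreal_ofReal.mul_const _)

/-- The joint distribution with feature marginal `Q` and regression function `η`. -/
noncomputable def jointLaw {d : ℕ} (Q : Measure (Feature d)) (η : Feature d → ℝ)
    (hη : Measurable η) : Measure (Obs d) :=
  Q ⊗ₘ labelKernel η hη

theorem norm_risk_le_one {d : ℕ} (P : Measure (Obs d)) [IsProbabilityMeasure P]
    (g : Feature d → Bool) : ‖risk P g‖ ≤ 1 := by
  rw [risk, Real.norm_eq_abs, abs_of_nonneg measureReal_nonneg]
  exact measureReal_le_one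

section JointLaw

variable {d : ℕ} {Q : Measure (Feature d)} [IsProbabilityMeasure Q] {η : Feature d → ℝ}
  {hη : Measurable η}

theorem isMarkovKernel_labelKernel (h0 : ∀ x, 0 ≤ η x) (h1 : ∀ x, η x ≤ 1) :
    IsMarkovKernel (labelKernel η hη) := by
  refine ⟨fun x => ⟨?_⟩⟩
  simp only [labelKernel, Kernel.coe_mk, Measure.coe_add, Measure.coe_smul, Pi.add_apply,
    Pi.smul_apply, measure_univ, smul_eq_mul, mul_one]
  rw [← ENNReal.ofReal_add (h0 x) (by linarith [h1 x])]
  simp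

theorem isProbabilityMeasure_jointLaw (h0 : ∀ x, 0 ≤ η x) (h1 : ∀ x, η x ≤ 1) :
    IsProbabilityMeasure (jointLaw Q η hη) := by
  have := isMarkovKernel_labelKernel (hη := hη) h0 h1
  unfold jointLaw
  infer_instance

theorem fst_jointLaw (h0 : ∀ x, 0 ≤ η x) (h1 : ∀ x, η x ≤ 1) :
    (jointLaw Q η hη).fst = Q := by
  have := isMarkovKernel_labelKernel (hη := hη) h0 h1
  exact Measure.fst_compProd _ _

theorem lintegral_jointLaw (h0 : ∀ x, 0 ≤ η x) (h1 : ∀ x, η x ≤ 1) {F : Obs d → ENNReal}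
    (hF : Measurable F) :
    ∫⁻ z, F z ∂(jointLaw Q η hη) = ∫⁻ x, (ENNReal.ofReal (η x) * F (x, true)
      + ENNReal.ofReal (1 - η x) * F (x, false)) ∂Q := by
  have := isMarkovKernel_labelKernel (hη := hη) h0 h1
  rw [jointLaw, Measure.lintegral_compProd hF]
  refine lintegral_congr fun x => ?_
  simp [labelKernel, lintegral_add_measure]

theorem integral_jointLaw (h0 : ∀ x, 0 ≤ η x) (h1 : ∀ x, η x ≤ 1) {F : Obs d → ℝ}
    (hF : Measurable F) {C : ℝ} (hC : ∀ z, |F z| ≤ C) :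
    ∫ z, F z ∂(jointLaw Q η hη) = ∫ x, (η x * F (x, true) + (1 - η x) * F (x, false)) ∂Q := by
  have := isMarkovKernel_labelKernel (hη := hη) h0 h1
  have hint : Integrable F (Q ⊗ₘ labelKernel η hη) :=
    Integrable.of_bound hF.aestronglyMeasurable C (ae_of_all _ hC)
  rw [jointLaw, Measure.integral_compProd hint]
  refine integral_congr_ae (ae_of_all _ fun x => ?_)
  have hi : ∀ (b : Bool) (r : ℝ), Integrable (fun y => F (x, y))
      (ENNReal.ofReal r • Measure.dirac b) := fun b r =>
    (integrable_dirac (by simp)).smul_measure ENNReal.ofReal_ne_top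
  simp only [labelKernel, Kernel.coe_mk]
  rw [integral_add_measure (hi _ _) (hi _ _), integral_smul_measure, integral_smul_measure,
    integral_dirac, integral_dirac, ENNReal.toReal_ofReal (h0 x),
    ENNReal.toReal_ofReal (by linarith [h1 x])]
  rfl

theorem regression_jointLaw [IsFiniteMeasure (jointLaw Q η hη)] (h0 : ∀ x, 0 ≤ η x)
    (h1 : ∀ x, η x ≤ 1) : η =ᵐ[Q] regression (jointLaw Q η hη) := by
  have := isMarkovKernel_labelKernel (hη := hη) h0 h1
  have hfst := fst_jointLaw (Q := Q) (hη := hη) h0 h1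
  have hcond := eq_condKernel_of_measure_eq_compProd (ρ := jointLaw Q η hη) (labelKernel η hη)
    (by rw [hfst]; rfl)
  rw [hfst] at hcond
  filter_upwards [hcond] with x hx
  rw [regression, ← hx]
  simp [labelKernel, Measure.real, h0 x]

theorem measurable_regression (P : Measure (Obs d)) [IsFiniteMeasure P] :
    Measurable (regression P) :=
  (Kernel.measurable_coe P.condKernel (MeasurableSet.singleton true)).ennreal_toReal

theorem measurable_bayesRule (P : Measure (Obs d)) [IsFiniteMeasure P] :
    Measurable (bayesRule P) := by
  refine measurable_to_bool ?_
  have : bayesRule P ⁻¹' {true} = {x | 1 / 2 ≤ regression P x} := by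
    ext x; simp [bayesRule]
  rw [this]
  exact measurableSet_le measurable_const (measurable_regression P)

theorem measurableSet_ne_prediction {g : Feature d → Bool} (hg : Measurable g) :
    MeasurableSet {z : Obs d | z.2 ≠ g z.1} :=
  (measurableSet_eq_fun measurable_snd (hg.comp measurable_fst)).compl

theorem risk_jointLaw (h0 : ∀ x, 0 ≤ η x) (h1 : ∀ x, η x ≤ 1) {g : Feature d → Bool}
    (hg : Measurable g) :
    risk (jointLaw Q η hη) g = ∫ x, (if g x then 1 - η x else η x) ∂Q := by
  have hS := measurableSet_ne_prediction hg
  have := isProbabilityMeasure_jointLaw (Q := Q) (hη := hη) h0 h1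
  rw [risk, ← integral_indicator_one hS, integral_jointLaw h0 h1
    (F := {z : Obs d | z.2 ≠ g z.1}.indicator 1) (measurable_one.indicator hS) (C := 1)]
  · refine integral_congr_ae (ae_of_all _ fun x => ?_)
    cases hgx : g x <;> simp [Set.indicator, hgx]
  · intro z
    by_cases hz : z ∈ {z : Obs d | z.2 ≠ g z.1}
    · rw [Set.indicator_of_mem hz]; simp
    · rw [Set.indicator_of_notMem hz]; simp

theorem integrable_pointwise_error (hη : Measurable η) (h0 : ∀ x, 0 ≤ η x) (h1 : ∀ x, η x ≤ 1)
    {g : Feature d → Bool} (hg : Measurable g) :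
    Integrable (fun x => if g x then 1 - η x else η x) Q := by
  refine Integrable.of_bound (Measurable.ite (hg (MeasurableSet.singleton true))
    (measurable_const.sub hη) hη).aestronglyMeasurable 1 (ae_of_all _ fun x => ?_)
  split_ifs <;> rw [Real.norm_eq_abs, abs_le] <;> constructor <;> linarith [h0 x, h1 x]

/-- The excess risk of a decision rule `g` is at least `2h` times the mass of the points of
`⋃ B j` where `g` predicts the wrong sign of `η - 1/2 = ± h`. -/
theorem sum_le_risk_sub_risk_bayesRule [IsFiniteMeasure (jointLaw Q η hη)] (h0 : ∀ x, 0 ≤ η x)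
    (h1 : ∀ x, η x ≤ 1)
    {ι : Type*} [Fintype ι] {B : ι → Set (Feature d)} (hB : ∀ i, MeasurableSet (B i))
    (hdisj : Pairwise fun i j => Disjoint (B i) (B j)) {t : ι → Bool} {h : ℝ} (hh : 0 < h)
    (hval : ∀ i, ∀ x ∈ B i, η x = 1 / 2 + if t i then h else -h)
    {g : Feature d → Bool} (hg : Measurable g) :
    ∑ i, 2 * h * Q.real {x | x ∈ B i ∧ g x ≠ t i}
      ≤ risk (jointLaw Q η hη) g - risk (jointLaw Q η hη) (bayesRule (jointLaw Q η hη)) := by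
  have hbm := measurable_bayesRule (jointLaw Q η hη)
  have hSm : ∀ i, MeasurableSet {x | x ∈ B i ∧ g x ≠ t i} := fun i =>
    (hB i).inter (measurableSet_eq_fun hg measurable_const).compl
  rw [risk_jointLaw h0 h1 hg, risk_jointLaw h0 h1 hbm,
    ← integral_sub (integrable_pointwise_error hη h0 h1 hg)
      (integrable_pointwise_error hη h0 h1 hbm)]
  have hint : ∀ i, Integrable (fun x => 2 * h *
      {x | x ∈ B i ∧ g x ≠ t i}.indicator (1 : Feature d → ℝ) x) Q := fun i =>
    ((integrable_const (1 : ℝ)).indicator (hSm i)).const_mul (2 * h)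
  have hleft : ∑ i, 2 * h * Q.real {x | x ∈ B i ∧ g x ≠ t i}
      = ∫ x, ∑ i, 2 * h * {x | x ∈ B i ∧ g x ≠ t i}.indicator (1 : Feature d → ℝ) x ∂Q := by
    rw [integral_finsetSum _ fun i _ => hint i]
    refine Finset.sum_congr rfl fun i _ => ?_
    rw [integral_const_mul, integral_indicator_one (hSm i)]
  rw [hleft]
  refine integral_mono_ae (integrable_finsetSum _ fun i _ => hint i)
    ((integrable_pointwise_error hη h0 h1 hg).sub (integrable_pointwise_error hη h0 h1 hbm)) ?_
  filter_upwards [regression_jointLaw (hη := hη) h0 h1] with x hx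
  have hbayes : bayesRule (jointLaw Q η hη) x = true ↔ 1 / 2 ≤ η x := by
    rw [bayesRule, ← hx]; simp
  have hnonneg : 0 ≤ (if g x then 1 - η x else η x)
      - (if bayesRule (jointLaw Q η hη) x then 1 - η x else η x) := by
    simp only [hbayes]
    split_ifs <;> linarith
  by_cases hxB : ∃ i, x ∈ B i
  · obtain ⟨i, hi⟩ := hxB
    rw [Finset.sum_eq_single i]
    · by_cases hgt : g x = t i
      · rw [Set.indicator_of_notMem (fun hmem => hmem.2 hgt), mul_zero]
        exact hnonneg
      · rw [Set.indicator_of_mem (show x ∈ {x | x ∈ B i ∧ g x ≠ t i} from ⟨hi, hgt⟩)]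
        have hv := hval i x hi
        simp only [hbayes, Pi.one_apply]
        cases hti : t i <;> cases hgx : g x <;> simp_all <;>
          split_ifs <;> linarith
    · intro j _ hji
      rw [Set.indicator_of_notMem (fun hmem => (hdisj hji).le_bot ⟨hmem.1, hi⟩), mul_zero]
    · simp
  · rw [Finset.sum_eq_zero fun i _ => by
      rw [Set.indicator_of_notMem (fun hmem => hxB ⟨i, hmem.1⟩), mul_zero]]
    exact hnonneg

theorem measurable_section_classifier {n : ℕ} {f : (Fin n → Obs d) → Feature d → Bool}
    (hf : IsClassifier f) (z : Fin n → Obs d) : Measurable (f z) :=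
  hf.comp measurable_prodMk_left

theorem measurable_measure_error {n : ℕ} {f : (Fin n → Obs d) → Feature d → Bool}
    (hf : IsClassifier f) {B : Set (Feature d)} (hB : MeasurableSet B) (b : Bool) :
    Measurable fun z => Q.real {x | x ∈ B ∧ f z x ≠ b} := by
  have hS : MeasurableSet {p : (Fin n → Obs d) × Feature d | p.2 ∈ B ∧ f p.1 p.2 ≠ b} :=
    (measurable_snd hB).inter (measurableSet_eq_fun hf measurable_const).compl
  exact (measurable_measure_prodMk_left (ν := Q) hS).ennreal_toReal

theorem measurable_risk {n : ℕ} (P : Measure (Obs d)) [IsFiniteMeasure P]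
    {f : (Fin n → Obs d) → Feature d → Bool} (hf : IsClassifier f) :
    Measurable fun z => risk P (f z) := by
  have hS : MeasurableSet {p : (Fin n → Obs d) × Obs d | p.2.2 ≠ f p.1 p.2.1} :=
    (measurableSet_eq_fun (measurable_snd.comp measurable_snd)
      (hf.comp (measurable_fst.prodMk (measurable_fst.comp measurable_snd)))).compl
  exact (measurable_measure_prodMk_left (ν := P) hS).ennreal_toReal

theorem sum_le_excessRisk [IsProbabilityMeasure (jointLaw Q η hη)] (h0 : ∀ x, 0 ≤ η x)
    (h1 : ∀ x, η x ≤ 1)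
    {ι : Type*} [Fintype ι] {B : ι → Set (Feature d)} (hB : ∀ i, MeasurableSet (B i))
    (hdisj : Pairwise fun i j => Disjoint (B i) (B j)) {t : ι → Bool} {h : ℝ} (hh : 0 < h)
    (hval : ∀ i, ∀ x ∈ B i, η x = 1 / 2 + if t i then h else -h)
    {n : ℕ} {f : (Fin n → Obs d) → Feature d → Bool} (hf : IsClassifier f) :
    ∑ i, 2 * h * ∫ z, Q.real {x | x ∈ B i ∧ f z x ≠ t i}
        ∂(Measure.pi fun _ : Fin n => jointLaw Q η hη)
      ≤ excessRisk (jointLaw Q η hη) f := by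
  have hri : Integrable (fun z => risk (jointLaw Q η hη) (f z))
      (Measure.pi fun _ : Fin n => jointLaw Q η hη) :=
    Integrable.of_bound (measurable_risk _ hf).aestronglyMeasurable 1
      (ae_of_all _ fun z => norm_risk_le_one _ _)
  have hei : ∀ i, Integrable (fun z => Q.real {x | x ∈ B i ∧ f z x ≠ t i})
      (Measure.pi fun _ : Fin n => jointLaw Q η hη) := fun i =>
    Integrable.of_bound (measurable_measure_error hf (hB i) (t i)).aestronglyMeasurable 1
      (ae_of_all _ fun z => by
        rw [Real.norm_eq_abs, abs_of_nonneg measureReal_nonneg]; exact measureReal_le_one)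
  have hconst : excessRisk (jointLaw Q η hη) f = ∫ z, (risk (jointLaw Q η hη) (f z)
      - risk (jointLaw Q η hη) (bayesRule (jointLaw Q η hη)))
        ∂(Measure.pi fun _ : Fin n => jointLaw Q η hη) := by
    rw [integral_sub hri (integrable_const _)]
    simp [excessRisk]
  rw [hconst]
  calc _ = ∫ z, ∑ i, 2 * h * Q.real {x | x ∈ B i ∧ f z x ≠ t i}
        ∂(Measure.pi fun _ : Fin n => jointLaw Q η hη) := by
        rw [integral_finsetSum _ fun i _ => (hei i).const_mul _]
        simp_rw [integral_const_mul]
    _ ≤ _ := integral_mono (integrable_finsetSum _ fun i _ => (hei i).const_mul _)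
        (hri.sub (integrable_const _)) fun z =>
          sum_le_risk_sub_risk_bayesRule h0 h1 hB hdisj hh hval
            (measurable_section_classifier hf z)

end JointLaw

theorem excessRisk_le_one {d n : ℕ} (P : Measure (Obs d)) [IsProbabilityMeasure P]
    (f : (Fin n → Obs d) → Feature d → Bool) : excessRisk P f ≤ 1 := by
  have h1 : ∫ z, risk P (f z) ∂(Measure.pi fun _ : Fin n => P) ≤ 1 := by
    have := norm_integral_le_of_norm_le_const (μ := Measure.pi fun _ : Fin n => P)
      (f := fun z => risk P (f z)) (C := 1) (ae_of_all _ fun z => norm_risk_le_one _ _)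
    rw [probReal_univ, mul_one] at this
    exact (le_abs_self _).trans this
  have h2 : 0 ≤ risk P (bayesRule P) := measureReal_nonneg
  unfold excessRisk
  linarith

theorem excessRisk_le_worstExcessRisk {d n : ℕ} {Ps : Set (ProbabilityMeasure (Obs d))}
    {P : ProbabilityMeasure (Obs d)} (hP : P ∈ Ps) (f : (Fin n → Obs d) → Feature d → Bool) :
    excessRisk (P : Measure (Obs d)) f ≤ worstExcessRisk Ps f :=
  le_ciSup (f := fun P : Ps => excessRisk ((P : ProbabilityMeasure (Obs d)) : Measure (Obs d)) f)
    ⟨1, by rintro _ ⟨P, rfl⟩; exact excessRisk_le_one _ f⟩ ⟨P, hP⟩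


/-! ### Averaging over sign patterns -/

/-- Flipping the sign of `η - 1/2 = τ` on a set `B` cannot be detected from `n` observations as
long as `n τ² Q(B)` is small. -/
theorem half_le_sum_errors_jointLaw {d : ℕ} {Q : Measure (Feature d)} [IsProbabilityMeasure Q]
    {η η' : Feature d → ℝ} {hη : Measurable η} {hη' : Measurable η'}
    (h0 : ∀ x, 1 / 4 ≤ η x) (h1 : ∀ x, η x ≤ 3 / 4) (h0' : ∀ x, 1 / 4 ≤ η' x)
    (h1' : ∀ x, η' x ≤ 3 / 4) {B : Set (Feature d)} (hB : MeasurableSet B) {τ : ℝ}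
    (hτ : |τ| ≤ 1 / 4)
    (hval : ∀ᵐ x ∂Q, (x ∈ B → η x = 1 / 2 + τ ∧ η' x = 1 / 2 - τ) ∧ (x ∉ B → η' x = η x))
    {n : ℕ} (hn : n * (22 * τ ^ 2 * Q.real B) ≤ 1 / 2) {g : (Fin n → Obs d) → ℝ}
    (hg : Measurable g) (hg0 : ∀ z, 0 ≤ g z) (hg1 : ∀ z, g z ≤ 1) :
    1 / 2 ≤ ∫ z, g z ∂(Measure.pi fun _ : Fin n => jointLaw Q η hη)
      + ∫ z, (1 - g z) ∂(Measure.pi fun _ : Fin n => jointLaw Q η' hη') := by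
  have u0 : ∀ x, 0 ≤ η x := fun x => by linarith [h0 x]
  have u1 : ∀ x, η x ≤ 1 := fun x => by linarith [h1 x]
  have u0' : ∀ x, 0 ≤ η' x := fun x => by linarith [h0' x]
  have u1' : ∀ x, η' x ≤ 1 := fun x => by linarith [h1' x]
  have := isProbabilityMeasure_jointLaw (Q := Q) (hη := hη) u0 u1
  set ρ : Obs d → ℝ := fun z => if z.2 then η' z.1 / η z.1 else (1 - η' z.1) / (1 - η z.1) with hρ
  have hρm : Measurable ρ := by
    refine Measurable.ite (measurable_snd (MeasurableSet.singleton true)) ?_ ?_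
    · exact (hη'.comp measurable_fst).div (hη.comp measurable_fst)
    · exact (measurable_const.sub (hη'.comp measurable_fst)).div
        (measurable_const.sub (hη.comp measurable_fst))
  have hρ0 : ∀ z, 0 ≤ ρ z := by
    rintro ⟨x, y⟩
    have := h0 x; have := h1 x; have := h0' x; have := h1' x
    simp only [hρ]
    split_ifs
    · exact div_nonneg (u0' x) (u0 x)
    · exact div_nonneg (by linarith) (by linarith)
  have hρ3 : ∀ z, ρ z ≤ 3 := by
    rintro ⟨x, y⟩
    have := h0 x; have := h1 x; have := h0' x; have := h1' x
    simp only [hρ]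
    split_ifs
    · rw [div_le_iff₀ (by linarith)]; linarith
    · rw [div_le_iff₀ (by linarith)]; linarith
  refine half_le_sum_errors (P := jointLaw Q η hη) (ρ := ρ) (B := 3)
    (χ := 22 * τ ^ 2 * Q.real B) hρm hρ0 hρ3 ?_ ?_ ?_ hn hg hg0 hg1
  · ext s hs
    rw [withDensity_apply _ hs, ← lintegral_indicator hs, ← lintegral_indicator_one hs,
      lintegral_jointLaw u0' u1' (measurable_one.indicator hs),
      lintegral_jointLaw u0 u1 (hρm.ennreal_ofReal.indicator hs)]
    refine lintegral_congr fun x => ?_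
    have hx0 := h0 x
    have hx1 := h1 x
    have key : ∀ (b : Bool) (r r' : ℝ), 0 < r → ρ (x, b) = r' / r →
        ENNReal.ofReal r' * s.indicator 1 (x, b)
          = ENNReal.ofReal r * s.indicator (fun z => ENNReal.ofReal (ρ z)) (x, b) := by
      intro b r r' hr hb
      by_cases hmem : (x, b) ∈ s
      · rw [Set.indicator_of_mem hmem, Set.indicator_of_mem hmem, hb, ← ENNReal.ofReal_mul hr.le,
          mul_div_cancel₀ _ hr.ne', Pi.one_apply, mul_one]
      · rw [Set.indicator_of_notMem hmem, Set.indicator_of_notMem hmem, mul_zero, mul_zero]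
    rw [key true (η x) (η' x) (by linarith) (by simp [hρ]),
      key false (1 - η x) (1 - η' x) (by linarith) (by simp [hρ])]
  · rw [integral_jointLaw u0 u1 hρm (C := 3) fun z => by rw [abs_of_nonneg (hρ0 z)]; exact hρ3 z]
    have : ∀ x, η x * ρ (x, true) + (1 - η x) * ρ (x, false) = 1 := by
      intro x
      have := h0 x
      have := h1 x
      simp only [hρ, if_true, Bool.false_eq_true, if_false]
      rw [mul_div_cancel₀ _ (by linarith), mul_div_cancel₀ _ (by linarith)]
      ring
    simp [this]
  · rw [integral_jointLaw u0 u1 (hρm.pow_const 2) (C := 9) fun z => by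
      rw [abs_of_nonneg (sq_nonneg _)]
      nlinarith [hρ0 z, hρ3 z]]
    have hle : ∀ᵐ x ∂Q, η x * ρ (x, true) ^ 2 + (1 - η x) * ρ (x, false) ^ 2
        ≤ 1 + 22 * τ ^ 2 * B.indicator 1 x := by
      filter_upwards [hval] with x hx
      have hx0 := h0 x
      have hx1 := h1 x
      simp only [hρ, if_true, Bool.false_eq_true, if_false]
      by_cases hxB : x ∈ B
      · obtain ⟨e1, e2⟩ := hx.1 hxB
        rw [Set.indicator_of_mem hxB, e1, e2, Pi.one_apply, mul_one]
        obtain ⟨l1, l2⟩ := abs_le.mp hτ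
        have p1 : 0 < 1 / 2 + τ := by linarith
        have p2 : 0 < 1 / 2 - τ := by linarith
        have hsq : τ ^ 2 ≤ 1 / 16 := by nlinarith
        have e3 : (1 / 2 + τ) * ((1 / 2 - τ) / (1 / 2 + τ)) ^ 2
            + (1 - (1 / 2 + τ)) * ((1 - (1 / 2 - τ)) / (1 - (1 / 2 + τ))) ^ 2
            = (1 / 4 + 3 * τ ^ 2) / (1 / 4 - τ ^ 2) := by
          have q1 : 1 - (1 / 2 + τ) = 1 / 2 - τ := by ring
          have q2 : 1 - (1 / 2 - τ) = 1 / 2 + τ := by ring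
          have q3 : 1 / 4 - τ ^ 2 = (1 / 2 + τ) * (1 / 2 - τ) := by ring
          rw [q1, q2, q3]
          have := p1.ne'
          have := p2.ne'
          field_simp
          ring
        rw [e3, div_le_iff₀ (by linarith)]
        nlinarith [sq_nonneg τ]
      · rw [Set.indicator_of_notMem hxB, hx.2 hxB, div_self (by linarith), div_self (by linarith)]
        linarith
    have hindB : Integrable (fun x => 22 * τ ^ 2 * B.indicator (1 : Feature d → ℝ) x) Q :=
      ((integrable_const (1 : ℝ)).indicator hB).const_mul (22 * τ ^ 2)
    have hind : Integrable (fun x => 1 + 22 * τ ^ 2 * B.indicator (1 : Feature d → ℝ) x) Q :=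
      (integrable_const 1).add hindB
    have hleft : Integrable (fun x => η x * ρ (x, true) ^ 2 + (1 - η x) * ρ (x, false) ^ 2) Q := by
      have hmt : Measurable fun x => ρ (x, true) :=
        hρm.comp (g := ρ) (f := fun x => (x, true)) measurable_prodMk_right
      have hmf : Measurable fun x => ρ (x, false) :=
        hρm.comp (g := ρ) (f := fun x => (x, false)) measurable_prodMk_right
      refine Integrable.of_bound ((hη.mul (hmt.pow_const 2)).add
        ((measurable_const.sub hη).mul (hmf.pow_const 2))).aestronglyMeasurable 9
        (ae_of_all _ fun x => ?_)
      have q : ∀ b, ρ (x, b) ^ 2 ≤ 9 := fun b => by nlinarith [hρ0 (x, b), hρ3 (x, b)]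
      have hx0 := h0 x
      have hx1 := h1 x
      have r1 := mul_le_mul_of_nonneg_left (q true) (u0 x)
      have r2 := mul_le_mul_of_nonneg_left (q false) (show 0 ≤ 1 - η x by linarith)
      have r3 : 0 ≤ η x * ρ (x, true) ^ 2 := mul_nonneg (u0 x) (sq_nonneg _)
      have r4 : 0 ≤ (1 - η x) * ρ (x, false) ^ 2 := mul_nonneg (by linarith) (sq_nonneg _)
      rw [Real.norm_eq_abs, abs_of_nonneg (by linarith)]
      linarith
    refine (integral_mono_ae hleft hind hle).trans (le_of_eq ?_)
    rw [integral_add (integrable_const _) hindB,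
      integral_const_mul, integral_indicator_one hB]
    simp

/-- The sign pattern `σ` with its `i`-th entry flipped. -/
def flipAt {ι : Type*} [DecidableEq ι] (i : ι) (σ : ι → Bool) : ι → Bool :=
  Function.update σ i (!σ i)

theorem flipAt_involutive {ι : Type*} [DecidableEq ι] (i : ι) :
    Function.Involutive (flipAt i) := by
  intro σ
  simp [flipAt]

/-- **Assouad's argument.** Suppose the signs of `η - 1/2 = ± h` on disjoint sets `B i` of equal
mass `ω` are free and each is undetectable. Pairing every sign pattern with its flip at `i` shows
that on average over patterns a classifier errs on at least a quarter of the mass of every `B i`. -/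
theorem card_mul_le_worstExcessRisk {d : ℕ} {Q : Measure (Feature d)} [IsProbabilityMeasure Q]
    {ι : Type*} [Fintype ι] [DecidableEq ι] {η : (ι → Bool) → Feature d → ℝ}
    (hη : ∀ σ, Measurable (η σ)) (h0 : ∀ σ x, 1 / 4 ≤ η σ x) (h1 : ∀ σ x, η σ x ≤ 3 / 4)
    {B : ι → Set (Feature d)} (hB : ∀ i, MeasurableSet (B i))
    (hdisj : Pairwise fun i j => Disjoint (B i) (B j)) {h ω : ℝ} (hh : 0 < h) (hh4 : h ≤ 1 / 4)
    (hω : 0 < ω) (hBω : ∀ i, Q.real (B i) = ω)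
    (hval : ∀ σ i, ∀ x ∈ B i, η σ x = 1 / 2 + if σ i then h else -h)
    (hoff : ∀ σ i, ∀ᵐ x ∂Q, x ∉ B i → η (flipAt i σ) x = η σ x)
    {n : ℕ} (hn : n * (22 * h ^ 2 * ω) ≤ 1 / 2)
    {Ps : Set (ProbabilityMeasure (Obs d))}
    (hPs : ∀ σ, ∃ P ∈ Ps, (P : Measure (Obs d)) = jointLaw Q (η σ) (hη σ))
    {f : (Fin n → Obs d) → Feature d → Bool} (hf : IsClassifier f) :
    Fintype.card ι * (h * ω / 2) ≤ worstExcessRisk Ps f := by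
  set T : (ι → Bool) → ι → ℝ := fun σ i => ∫ z, Q.real {x | x ∈ B i ∧ f z x ≠ σ i}
    ∂(Measure.pi fun _ : Fin n => jointLaw Q (η σ) (hη σ)) with hT
  have u0 : ∀ σ x, 0 ≤ η σ x := fun σ x => by linarith [h0 σ x]
  have u1 : ∀ σ x, η σ x ≤ 1 := fun σ x => by linarith [h1 σ x]
  have hprob : ∀ σ, IsProbabilityMeasure (jointLaw Q (η σ) (hη σ)) := fun σ =>
    isProbabilityMeasure_jointLaw (u0 σ) (u1 σ)
  have hrisk : ∀ σ, ∑ i, 2 * h * T σ i ≤ worstExcessRisk Ps f := by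
    intro σ
    obtain ⟨P, hP, hPeq⟩ := hPs σ
    have h2 := sum_le_excessRisk (Q := Q) (hη := hη σ) (u0 σ) (u1 σ) hB hdisj hh (hval σ) hf
    refine h2.trans (le_trans (le_of_eq ?_) (excessRisk_le_worstExcessRisk hP f))
    congr 1
    exact hPeq.symm
  have hpair : ∀ i σ, ω / 2 ≤ T σ i + T (flipAt i σ) i := by
    intro i σ
    have hflip : flipAt i σ i = !σ i := by simp [flipAt]
    have hgm := measurable_measure_error (Q := Q) hf (hB i) (σ i)
    have hle : ∀ z, Q.real {x | x ∈ B i ∧ f z x ≠ σ i} ≤ ω := fun z => by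
      rw [← hBω i]
      exact measureReal_mono fun x hx => hx.1
    have hcompl : ∀ z, Q.real {x | x ∈ B i ∧ f z x ≠ flipAt i σ i}
        = ω * (1 - Q.real {x | x ∈ B i ∧ f z x ≠ σ i} / ω) := by
      intro z
      rw [mul_sub, mul_one, mul_div_cancel₀ _ hω.ne', ← hBω i]
      have hm : MeasurableSet {x | f z x ≠ σ i} :=
        (measurableSet_eq_fun (measurable_section_classifier hf z) measurable_const).compl
      have hsplit := measureReal_inter_add_sdiff (μ := Q) (s := B i) hm
      have e1 : B i ∩ {x | f z x ≠ σ i} = {x | x ∈ B i ∧ f z x ≠ σ i} := rfl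
      have e2 : B i \ {x | f z x ≠ σ i} = {x | x ∈ B i ∧ f z x ≠ flipAt i σ i} := by
        ext x
        rw [hflip]
        cases hs : σ i <;> cases hz : f z x <;> simp [hz]
      rw [e1, e2] at hsplit
      linarith
    have htest := half_le_sum_errors_jointLaw (Q := Q) (hη := hη σ) (hη' := hη (flipAt i σ))
      (h0 σ) (h1 σ) (h0 _) (h1 _) (hB i) (τ := if σ i then h else -h) (n := n)
      (by split_ifs <;> simpa [abs_of_pos hh] using hh4)
      (by
        filter_upwards [hoff σ i] with x hx
        refine ⟨fun hxB => ⟨hval σ i x hxB, ?_⟩, hx⟩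
        rw [hval (flipAt i σ) i x hxB, hflip]
        cases σ i <;> simp
        ring)
      (by
        rw [hBω i]
        have : (if σ i then h else -h) ^ 2 = h ^ 2 := by split_ifs <;> ring
        rw [this]; exact hn)
      (g := fun z => Q.real {x | x ∈ B i ∧ f z x ≠ σ i} / ω) (hgm.div_const ω)
      (fun z => div_nonneg measureReal_nonneg hω.le)
      (fun z => (div_le_one hω).mpr (hle z))
    have hT1 : T σ i = ω * ∫ z, Q.real {x | x ∈ B i ∧ f z x ≠ σ i} / ω
        ∂(Measure.pi fun _ : Fin n => jointLaw Q (η σ) (hη σ)) := by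
      rw [integral_div, mul_div_cancel₀ _ hω.ne']
    have hT2 : T (flipAt i σ) i = ω * ∫ z, (1 - Q.real {x | x ∈ B i ∧ f z x ≠ σ i} / ω)
        ∂(Measure.pi fun _ : Fin n => jointLaw Q (η (flipAt i σ)) (hη (flipAt i σ))) := by
      simp only [hT]
      simp_rw [hcompl]
      rw [integral_const_mul]
    rw [hT1, hT2, ← mul_add]
    calc ω / 2 = ω * (1 / 2) := by ring
      _ ≤ _ := mul_le_mul_of_nonneg_left htest hω.le
  have havg : ∀ i, Fintype.card (ι → Bool) * (ω / 4) ≤ ∑ σ, T σ i := by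
    intro i
    have hperm : ∑ σ, T (flipAt i σ) i = ∑ σ, T σ i :=
      Equiv.sum_comp (flipAt_involutive i).toPerm fun σ => T σ i
    have h3 : ∑ _σ : ι → Bool, ω / 2 ≤ ∑ σ, (T σ i + T (flipAt i σ) i) :=
      Finset.sum_le_sum fun σ _ => hpair i σ
    rw [Finset.sum_add_distrib, hperm, Finset.sum_const, Finset.card_univ, nsmul_eq_mul] at h3
    linarith
  have htotal : (Fintype.card (ι → Bool) : ℝ) * (Fintype.card ι * (h * ω / 2))
      ≤ Fintype.card (ι → Bool) * worstExcessRisk Ps f := by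
    calc (Fintype.card (ι → Bool) : ℝ) * (Fintype.card ι * (h * ω / 2))
        = ∑ _i : ι, 2 * h * (Fintype.card (ι → Bool) * (ω / 4)) := by
          rw [Finset.sum_const, Finset.card_univ, nsmul_eq_mul]; ring
      _ ≤ ∑ i, 2 * h * ∑ σ, T σ i := Finset.sum_le_sum fun i _ =>
          mul_le_mul_of_nonneg_left (havg i) (by positivity)
      _ = ∑ σ, ∑ i, 2 * h * T σ i := by
          rw [Finset.sum_comm]; simp_rw [Finset.mul_sum]
      _ ≤ ∑ _σ : ι → Bool, worstExcessRisk Ps f := Finset.sum_le_sum fun σ _ => hrisk σ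
      _ = _ := by rw [Finset.sum_const, Finset.card_univ, nsmul_eq_mul]
  exact le_of_mul_le_mul_left htotal (by exact_mod_cast Fintype.card_pos)


/-! ### Removing thin spherical shells from a regular set -/

theorem volume_real_closedBall {d : ℕ} (x : Feature d) {r : ℝ} (hr : 0 ≤ r) :
    volume.real (Metric.closedBall x r) = r ^ d * volume.real (Metric.ball (0 : Feature d) 1) := by
  rw [Measure.addHaar_real_closedBall volume x hr, finrank_euclideanSpace_fin]

theorem volume_real_unitBall_pos (d : ℕ) : 0 < volume.real (Metric.ball (0 : Feature d) 1) :=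
  ENNReal.toReal_pos (Metric.measure_ball_pos volume _ one_pos).ne' measure_ball_lt_top.ne

theorem volume_real_mono {d : ℕ} {S T : Set (Feature d)} (h : S ⊆ T) {x : Feature d} {r : ℝ}
    (hT : T ⊆ Metric.closedBall x r) : volume.real S ≤ volume.real T :=
  measureReal_mono h ((measure_mono hT).trans_lt measure_closedBall_lt_top).ne

theorem volume_real_preimage_sub_left {d : ℕ} (c : Feature d) (S : Set (Feature d))
    (hS : MeasurableSet S) : volume.real ((fun y => c - y) ⁻¹' S) = volume.real S := by
  have := (Measure.measurePreserving_sub_left (volume : Measure (Feature d)) c).measure_preimage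
    hS.nullMeasurableSet
  rw [measureReal_def, this, measureReal_def]

theorem measurableSet_halfSpace {d : ℕ} (x v : Feature d) (c : ℝ) :
    MeasurableSet {y : Feature d | inner ℝ v (y - x) ≤ c} :=
  measurableSet_le (by fun_prop) measurable_const

/-- The point reflection in the centre exchanges the two halves of a ball. -/
theorem half_le_volume_halfBall {d : ℕ} (x v : Feature d) (r : ℝ) :
    volume.real (Metric.closedBall x r) / 2
      ≤ volume.real (Metric.closedBall x r ∩ {y | inner ℝ v (y - x) ≤ 0}) := by
  set H := Metric.closedBall x r ∩ {y | inner ℝ v (y - x) ≤ 0} with hH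
  have hHm : MeasurableSet H :=
    Metric.isClosed_closedBall.measurableSet.inter (measurableSet_halfSpace x v 0)
  have hcover : Metric.closedBall x r ⊆ H ∪ (fun y => (2 : ℝ) • x - y) ⁻¹' H := by
    intro y hy
    have e : (2 : ℝ) • x - y - x = -(y - x) := by rw [two_smul]; abel
    rcases le_total (inner ℝ v (y - x)) 0 with h | h
    · exact Or.inl ⟨hy, h⟩
    · refine Or.inr ⟨?_, ?_⟩
      · rw [Metric.mem_closedBall, dist_eq_norm] at hy ⊢
        rwa [e, norm_neg]
      · change inner ℝ v ((2 : ℝ) • x - y - x) ≤ 0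
        rw [e, inner_neg_right]
        linarith
  have hfin : volume H ≠ ⊤ :=
    ((measure_mono Set.inter_subset_left).trans_lt measure_closedBall_lt_top).ne
  have hfin' : volume ((fun y => (2 : ℝ) • x - y) ⁻¹' H) ≠ ⊤ := by
    rwa [(Measure.measurePreserving_sub_left (volume : Measure (Feature d))
      ((2 : ℝ) • x)).measure_preimage hHm.nullMeasurableSet]
  have h1 := (measureReal_mono hcover (measure_union_lt_top hfin.lt_top hfin'.lt_top).ne).trans
    (measureReal_union_le (μ := volume) _ _)
  rw [volume_real_preimage_sub_left _ _ hHm] at h1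
  linarith

/-- A cap of a ball cut off at distance `s r` from the centre contains a translate of a half-ball
of radius `(1 - s) r`. -/
theorem le_volume_cap {d : ℕ} (x u : Feature d) (hu : ‖u‖ = 1) {r s : ℝ} (hr : 0 ≤ r)
    (hs0 : 0 ≤ s) (hs1 : s ≤ 1) :
    (1 - s) ^ d / 2 * volume.real (Metric.closedBall x r)
      ≤ volume.real (Metric.closedBall x r ∩ {y | inner ℝ u (y - x) ≤ -(s * r)}) := by
  set T := Metric.closedBall x r ∩ {y | inner ℝ u (y - x) ≤ -(s * r)} with hT
  have hTm : MeasurableSet T :=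
    Metric.isClosed_closedBall.measurableSet.inter (measurableSet_halfSpace x u _)
  have hsub : Metric.closedBall x ((1 - s) * r) ∩ {y | inner ℝ u (y - x) ≤ 0}
      ⊆ (fun y => y + -((s * r) • u)) ⁻¹' T := by
    rintro y ⟨hy, hy'⟩
    have e : y + -((s * r) • u) - x = (y - x) - (s * r) • u := by abel
    rw [Metric.mem_closedBall, dist_eq_norm] at hy
    refine ⟨?_, ?_⟩
    · rw [Metric.mem_closedBall, dist_eq_norm, e]
      refine (norm_sub_le _ _).trans ?_
      rw [norm_smul, hu, Real.norm_eq_abs, abs_of_nonneg (by positivity)]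
      linarith
    · change inner ℝ u (y + -((s * r) • u) - x) ≤ -(s * r)
      rw [e, inner_sub_right, inner_smul_right, real_inner_self_eq_norm_sq, hu]
      have : inner ℝ u (y - x) ≤ 0 := hy'
      linarith
  have hpre : volume ((fun y => y + -((s * r) • u)) ⁻¹' T) = volume T :=
    measure_preimage_add_right _ _ _
  have hfin : volume T ≠ ⊤ :=
    ((measure_mono Set.inter_subset_left).trans_lt measure_closedBall_lt_top).ne
  have h1 : volume.real (Metric.closedBall x ((1 - s) * r) ∩ {y | inner ℝ u (y - x) ≤ 0})
      ≤ volume.real T := by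
    refine (measureReal_mono hsub (by rwa [hpre])).trans (le_of_eq ?_)
    rw [measureReal_def, hpre, measureReal_def]
  have h2 := half_le_volume_halfBall x u ((1 - s) * r)
  rw [volume_real_closedBall x (mul_nonneg (by linarith) hr)] at h2
  rw [volume_real_closedBall x hr]
  rw [mul_pow] at h2
  linarith

/-- A small ball centred in a ball of radius `a` lies in it up to slightly more than one half. -/
theorem le_volume_inter_closedBall {d : ℕ} {x z : Feature d} {a r s : ℝ} (hs : 0 < s)
    (hs2 : s ≤ 1 / 2) (hx : dist x z ≤ a) (hr : 0 ≤ r) (hra : r ≤ s * a) :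
    (1 - s) ^ d / 2 * volume.real (Metric.closedBall x r)
      ≤ volume.real (Metric.closedBall x r ∩ Metric.closedBall z a) := by
  have ha : 0 ≤ a := dist_nonneg.trans hx
  rcases le_or_gt (dist x z) (a / 2) with hD | hD
  · have hsub : Metric.closedBall x r ⊆ Metric.closedBall z a := by
      refine Metric.closedBall_subset_closedBall' ?_
      nlinarith
    rw [Set.inter_eq_left.mpr hsub]
    have : (1 - s) ^ d ≤ 1 := pow_le_one₀ (by linarith) (by linarith)
    nlinarith [measureReal_nonneg (μ := volume) (s := Metric.closedBall x r)]
  · have hDpos : 0 < ‖x - z‖ := by rw [← dist_eq_norm]; linarith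
    rw [dist_eq_norm] at hx hD
    have hu : ‖(‖x - z‖)⁻¹ • (x - z)‖ = 1 := by
      rw [norm_smul, norm_inv, norm_norm, inv_mul_cancel₀ hDpos.ne']
    refine (le_volume_cap x _ hu hr hs.le (by linarith)).trans
      (volume_real_mono ?_ Set.inter_subset_left)
    rintro y ⟨hy, hy'⟩
    refine ⟨hy, ?_⟩
    rw [Metric.mem_closedBall, dist_eq_norm] at hy ⊢
    have hin : inner ℝ ((‖x - z‖)⁻¹ • (x - z)) (y - x) ≤ -(s * r) := hy'
    rw [real_inner_smul_left, inv_mul_le_iff₀ hDpos] at hin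
    have e : y - z = (x - z) + (y - x) := by abel
    have hsq : ‖y - z‖ ^ 2 ≤ ‖x - z‖ ^ 2 := by
      rw [e, norm_add_sq_real]
      have h1 : ‖y - x‖ ^ 2 ≤ r ^ 2 := pow_le_pow_left₀ (norm_nonneg _) hy 2
      -- `r ≤ s a ≤ 2 s ‖x - z‖`, so the inner product dominates the quadratic term
      have h2 : r * r ≤ r * (2 * s * ‖x - z‖) :=
        mul_le_mul_of_nonneg_left (by nlinarith) hr
      nlinarith
    exact (pow_le_pow_iff_left₀ (norm_nonneg _) (norm_nonneg _) two_ne_zero).mp hsq |>.trans hx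

/-- Half of a ball centred off an open ball stays off that open ball. -/
theorem half_le_volume_diff_ball {d : ℕ} {x z : Feature d} {R : ℝ} (hx : R ≤ dist x z) (r : ℝ) :
    volume.real (Metric.closedBall x r) / 2
      ≤ volume.real (Metric.closedBall x r ∩ {y | R ≤ dist y z}) := by
  refine (half_le_volume_halfBall x (-(x - z)) r).trans
    (volume_real_mono ?_ Set.inter_subset_left)
  rintro y ⟨hy, hy'⟩
  refine ⟨hy, ?_⟩
  have hin : inner ℝ (-(x - z)) (y - x) ≤ 0 := hy'
  rw [inner_neg_left] at hin
  have e : y - z = (x - z) + (y - x) := by abel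
  have hsq : ‖x - z‖ ^ 2 ≤ ‖y - z‖ ^ 2 := by
    rw [e, norm_add_sq_real]
    nlinarith [sq_nonneg ‖y - x‖]
  rw [dist_eq_norm] at hx
  change R ≤ dist y z
  rw [dist_eq_norm]
  exact hx.trans ((pow_le_pow_iff_left₀ (norm_nonneg _) (norm_nonneg _) two_ne_zero).mp hsq)

/-- A bounded nonempty regular set has regularity constant at most `1/2`: at a point of maximal
norm, the set and its point reflection overlap in a null set only. -/
theorem regular_const_le_half {d : ℕ} {c r : ℝ} {A : Set (Feature d)} (hd : 1 ≤ d)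
    (hA : IsCompact A) (hne : A.Nonempty) (hr : 0 < r) (hreg : IsRegularSet c r A) :
    c ≤ 1 / 2 := by
  have : Nonempty (Fin d) := ⟨⟨0, hd⟩⟩
  obtain ⟨x, hxA, hmax⟩ := hA.exists_isMaxOn hne continuous_norm.continuousOn
  have hmax' : ∀ y ∈ A, ‖y‖ ≤ ‖x‖ := fun y hy => hmax hy
  set S := A ∩ Metric.closedBall x r with hS
  have hSm : MeasurableSet S :=
    hA.isClosed.measurableSet.inter Metric.isClosed_closedBall.measurableSet
  set S' := (fun y => (2 : ℝ) • x - y) ⁻¹' S with hS'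
  have hS'm : MeasurableSet S' := (by fun_prop : Measurable fun y => (2 : ℝ) • x - y) hSm
  have hinter : S ∩ S' ⊆ Metric.sphere 0 ‖x‖ := by
    rintro y ⟨hy, hy'⟩
    have h1 := hmax' y hy.1
    have h2 : ‖(2 : ℝ) • x - y‖ ≤ ‖x‖ := hmax' _ hy'.1
    have h3 : ‖(2 : ℝ) • x‖ ≤ ‖(2 : ℝ) • x - y‖ + ‖y‖ := by
      simpa using norm_add_le ((2 : ℝ) • x - y) y
    rw [norm_smul, Real.norm_eq_abs, abs_of_pos two_pos] at h3
    rw [mem_sphere_zero_iff_norm]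
    linarith
  have hae : AEDisjoint volume S S' :=
    measure_mono_null hinter (Measure.addHaar_sphere volume _ _)
  have hsub : S ∪ S' ⊆ Metric.closedBall x r := by
    rintro y (hy | hy)
    · exact hy.2
    · have h := hy.2
      rw [Metric.mem_closedBall, dist_eq_norm] at h ⊢
      have e : (2 : ℝ) • x - y - x = -(y - x) := by rw [two_smul]; abel
      rwa [e, norm_neg] at h
  have hfin : ∀ T ⊆ Metric.closedBall x r, volume T ≠ ⊤ := fun T hT =>
    ((measure_mono hT).trans_lt measure_closedBall_lt_top).ne
  have hunion : volume.real (S ∪ S') = volume.real S + volume.real S' := by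
    rw [measureReal_def, measure_union₀ hS'm.nullMeasurableSet hae, ENNReal.toReal_add
      (hfin _ (Set.subset_union_left.trans hsub)) (hfin _ (Set.subset_union_right.trans hsub))]
    rfl
  have hle := volume_real_mono hsub subset_rfl
  rw [hunion, hS', volume_real_preimage_sub_left _ _ hSm] at hle
  have hB := hreg.2 r hr le_rfl x hxA
  have hpos : 0 < volume.real (Metric.closedBall x r) := by
    rw [volume_real_closedBall x hr.le]
    exact mul_pos (pow_pos hr d) (volume_real_unitBall_pos d)
  nlinarith

/-- The union of the open spherical shells with radii `a` and `(1 + ε) a` around the points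
`z i`. -/
def shells {d : ℕ} {ι : Type*} (z : ι → Feature d) (a ε : ℝ) : Set (Feature d) :=
  ⋃ i, {x | a < dist x (z i) ∧ dist x (z i) < (1 + ε) * a}

theorem isOpen_shells {d : ℕ} {ι : Type*} (z : ι → Feature d) (a ε : ℝ) :
    IsOpen (shells z a ε) :=
  isOpen_iUnion fun _ =>
    (isOpen_lt continuous_const (continuous_id.dist continuous_const)).and
      (isOpen_lt (continuous_id.dist continuous_const) continuous_const)

/-- The part of the shells near `T` has volume at most `((1 + ε)^d - 1)` times that of any set
containing the balls that the shells meeting `T` surround. -/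
theorem volume_shells_inter_le {d : ℕ} {ι : Type*} [Fintype ι] {z : ι → Feature d} {a ε : ℝ}
    (ha : 0 < a) (hε : 0 < ε) (hsep : Pairwise fun i j => 2 * a < dist (z i) (z j))
    {S T : Set (Feature d)} (hS : volume S ≠ ⊤)
    (hST : ∀ i, ∀ x ∈ T, dist x (z i) < (1 + ε) * a → Metric.closedBall (z i) a ⊆ S) :
    volume.real (shells z a ε ∩ T) ≤ ((1 + ε) ^ d - 1) * volume.real S := by
  classical
  set J : Finset ι := {i | ∃ x ∈ T, dist x (z i) < (1 + ε) * a} with hJ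
  have hshell : ∀ i, volume.real {x | a < dist x (z i) ∧ dist x (z i) < (1 + ε) * a}
      ≤ ((1 + ε) ^ d - 1) * volume.real (Metric.closedBall (z i) a) := by
    intro i
    have hsub : {x | a < dist x (z i) ∧ dist x (z i) < (1 + ε) * a}
        ⊆ Metric.closedBall (z i) ((1 + ε) * a) \ Metric.closedBall (z i) a :=
      fun x hx => ⟨hx.2.le, fun h => absurd hx.1 (not_lt.mpr h)⟩
    refine (volume_real_mono hsub Set.sdiff_subset).trans (le_of_eq ?_)
    rw [measureReal_sdiff (Metric.closedBall_subset_closedBall (by nlinarith))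
      Metric.isClosed_closedBall.measurableSet measure_closedBall_lt_top.ne,
      volume_real_closedBall _ (by positivity), volume_real_closedBall _ ha.le, mul_pow]
    ring
  have hκ : 0 ≤ (1 + ε) ^ d - 1 := by
    have : 1 ≤ (1 + ε) ^ d := one_le_pow₀ (by linarith)
    linarith
  have hcover : shells z a ε ∩ T
      ⊆ ⋃ i ∈ J, {x | a < dist x (z i) ∧ dist x (z i) < (1 + ε) * a} := by
    rintro x ⟨hx, hxT⟩
    obtain ⟨i, hi⟩ := Set.mem_iUnion.mp hx
    exact Set.mem_biUnion (show i ∈ J by simp [hJ]; exact ⟨x, hxT, hi.2⟩) hi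
  have hfinu : volume (⋃ i ∈ J, {x | a < dist x (z i) ∧ dist x (z i) < (1 + ε) * a}) ≠ ⊤ := by
    refine (measure_biUnion_lt_top J.finite_toSet fun i _ => ?_).ne
    exact (measure_mono fun x hx => (hx.2.le : x ∈ Metric.closedBall (z i) ((1 + ε) * a))).trans_lt
      measure_closedBall_lt_top
  have hballs : ∑ i ∈ J, volume.real (Metric.closedBall (z i) a) ≤ volume.real S := by
    rw [← measureReal_biUnion_finset (f := fun i => Metric.closedBall (z i) a) (μ := volume)
      (fun i _ j _ hij => Metric.closedBall_disjoint_closedBall (by linarith [hsep hij]))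
      (fun i _ => Metric.isClosed_closedBall.measurableSet)
      (fun i _ => measure_closedBall_lt_top.ne)]
    refine measureReal_mono (Set.iUnion₂_subset fun i hi => ?_) hS
    obtain ⟨x, hxT, hx⟩ : ∃ x ∈ T, dist x (z i) < (1 + ε) * a := by simpa [hJ] using hi
    exact hST i x hxT hx
  calc volume.real (shells z a ε ∩ T)
      ≤ volume.real (⋃ i ∈ J, {x | a < dist x (z i) ∧ dist x (z i) < (1 + ε) * a}) :=
        measureReal_mono hcover hfinu
    _ ≤ ∑ i ∈ J, volume.real {x | a < dist x (z i) ∧ dist x (z i) < (1 + ε) * a} :=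
        measureReal_biUnion_finset_le _ _
    _ ≤ ∑ i ∈ J, ((1 + ε) ^ d - 1) * volume.real (Metric.closedBall (z i) a) :=
        Finset.sum_le_sum fun i _ => hshell i
    _ ≤ ((1 + ε) ^ d - 1) * volume.real S := by
        rw [← Finset.mul_sum]
        exact mul_le_mul_of_nonneg_left hballs hκ

/-- Removing thin shells deep inside a regular set costs arbitrarily little regularity. Balls of
radius at least `s a` lose little volume because the shells are thin; smaller balls meet at most
one shell, and see either side of it as nearly a half-space. -/
theorem isRegularSet_diff_shells {d : ℕ} {ι : Type*} [Fintype ι] {c₀ c₁ r₀ s ε a : ℝ}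
    {A : Set (Feature d)} (hA : IsCompact A) (hreg : IsRegularSet c₁ r₀ A) (hc : c₀ ≤ c₁)
    (hs : 0 < s) (hs2 : s ≤ 1 / 2) (hhalf : c₀ ≤ (1 - s) ^ d / 2) (hε0 : 0 < ε) (hε1 : ε ≤ 1)
    (hκ : ((1 + ε) ^ d - 1) * (1 + 3 / s) ^ d ≤ c₁ - c₀) (ha : 0 < a) {z : ι → Feature d}
    (hsep : Pairwise fun i j => 6 * a < dist (z i) (z j))
    (hzA : ∀ i, Metric.closedBall (z i) (4 * a) ⊆ A) :
    IsRegularSet c₀ r₀ (A \ shells z a ε) := by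
  refine ⟨(hA.isClosed.measurableSet.diff (isOpen_shells z a ε).measurableSet).nullMeasurableSet,
    fun r hr hr0 x hx => ?_⟩
  have hregx := hreg.2 r hr hr0 x hx.1
  set V := volume.real (Metric.closedBall x r) with hV
  have hV0 : 0 ≤ V := measureReal_nonneg
  rcases le_or_gt (s * a) r with hlarge | hsmall
  · have hloc : volume.real (shells z a ε ∩ Metric.closedBall x r)
        ≤ ((1 + ε) ^ d - 1) * volume.real (Metric.closedBall x (r + 3 * a)) := by
      refine volume_shells_inter_le ha hε0 (fun i j hij => by linarith [hsep hij])
        measure_closedBall_lt_top.ne fun i y hy hyi => ?_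
      refine Metric.closedBall_subset_closedBall' ?_
      have h1 : dist y x ≤ r := hy
      have h2 := dist_triangle_left (z i) x y
      nlinarith
    have hgrow : volume.real (Metric.closedBall x (r + 3 * a)) ≤ (1 + 3 / s) ^ d * V := by
      rw [hV, volume_real_closedBall x hr.le, volume_real_closedBall x (by positivity),
        ← mul_assoc, ← mul_pow]
      refine mul_le_mul_of_nonneg_right (pow_le_pow_left₀ (by positivity) ?_ d)
        measureReal_nonneg
      have : a ≤ r / s := by rw [le_div_iff₀ hs]; linarith
      calc r + 3 * a ≤ r + 3 * (r / s) := by linarith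
        _ = (1 + 3 / s) * r := by ring
    have hκ0 : 0 ≤ (1 + ε) ^ d - 1 := by
      have : 1 ≤ (1 + ε) ^ d := one_le_pow₀ (by linarith)
      linarith
    have hsplit : volume.real (A ∩ Metric.closedBall x r)
        ≤ volume.real ((A \ shells z a ε) ∩ Metric.closedBall x r)
          + volume.real (shells z a ε ∩ Metric.closedBall x r) := by
      refine (volume_real_mono (T := ((A \ shells z a ε) ∩ Metric.closedBall x r)
        ∪ (shells z a ε ∩ Metric.closedBall x r)) (x := x) (r := r) ?_ ?_).trans
          (measureReal_union_le _ _)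
      · rintro y ⟨hyA, hyB⟩
        by_cases hys : y ∈ shells z a ε
        · exact Or.inr ⟨hys, hyB⟩
        · exact Or.inl ⟨⟨hyA, hys⟩, hyB⟩
      · exact Set.union_subset Set.inter_subset_right Set.inter_subset_right
    have h3 := mul_le_mul_of_nonneg_left hgrow hκ0
    have h4 := mul_le_mul_of_nonneg_right hκ hV0
    rw [← mul_assoc] at h3
    linarith
  · have hra : r < a := by nlinarith
    by_cases hnear : ∃ i, dist x (z i) ≤ 3 * a
    · obtain ⟨i, hi⟩ := hnear
      have hin : ∀ y ∈ Metric.closedBall x r,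
          ¬ (a < dist y (z i) ∧ dist y (z i) < (1 + ε) * a) → y ∈ A \ shells z a ε := by
        intro y hy hyi
        have hyx : dist y x ≤ r := hy
        refine ⟨hzA i ?_, fun hmem => ?_⟩
        · rw [Metric.mem_closedBall]
          linarith [dist_triangle y x (z i)]
        · obtain ⟨j, hj⟩ := Set.mem_iUnion.mp hmem
          by_cases hji : i = j
          · subst hji; exact hyi hj
          · have h1 := hsep hji
            have h2 := dist_triangle_left (z i) (z j) x
            have h3 := dist_triangle_left x (z j) y
            have h4 : dist y (z j) < (1 + ε) * a := hj.2
            nlinarith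
      have hxi : dist x (z i) ≤ a ∨ (1 + ε) * a ≤ dist x (z i) := by
        by_contra hcon
        push Not at hcon
        exact hx.2 (Set.mem_iUnion.mpr ⟨i, hcon⟩)
      rcases hxi with hxi | hxi
      · calc c₀ * V ≤ (1 - s) ^ d / 2 * V := mul_le_mul_of_nonneg_right hhalf hV0
          _ ≤ volume.real (Metric.closedBall x r ∩ Metric.closedBall (z i) a) :=
            le_volume_inter_closedBall hs hs2 hxi hr.le hsmall.le
          _ ≤ _ := volume_real_mono (Set.subset_inter (fun y hy => hin y hy.1 fun h =>
            absurd h.1 (not_lt.mpr hy.2)) Set.inter_subset_left) Set.inter_subset_right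
      · have hle : (1 - s) ^ d ≤ 1 := pow_le_one₀ (by linarith) (by linarith)
        calc c₀ * V ≤ V / 2 := by nlinarith
          _ ≤ volume.real (Metric.closedBall x r ∩ {y | (1 + ε) * a ≤ dist y (z i)}) :=
            half_le_volume_diff_ball hxi r
          _ ≤ _ := volume_real_mono (Set.subset_inter (fun y hy => hin y hy.1 fun h =>
            absurd h.2 (not_lt.mpr hy.2)) Set.inter_subset_left) Set.inter_subset_right
    · push Not at hnear
      have heq : (A \ shells z a ε) ∩ Metric.closedBall x r = A ∩ Metric.closedBall x r := by
        refine Set.Subset.antisymm (Set.inter_subset_inter_left _ Set.sdiff_subset) ?_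
        rintro y ⟨hyA, hyB⟩
        refine ⟨⟨hyA, fun hmem => ?_⟩, hyB⟩
        obtain ⟨j, hj⟩ := Set.mem_iUnion.mp hmem
        have h1 := hnear j
        have h2 : dist y x ≤ r := hyB
        have h3 := dist_triangle_left x (z j) y
        have h4 : dist y (z j) < (1 + ε) * a := hj.2
        nlinarith
      rw [heq]
      nlinarith

/-- A ball of radius `ρ` contains `m` points at mutual distances greater than `6a` as soon as
`m (14 d a)^d ≤ ρ^d`: take points of a cubic grid of mesh `7a`. -/
theorem exists_separated_points {d : ℕ} (hd : 1 ≤ d) (x₀ : Feature d) {a ρ : ℝ} (ha : 0 < a)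
    (hρ : 0 < ρ) {m : ℕ} (hm : 1 ≤ m) (hmρ : m * (14 * d * a) ^ d ≤ ρ ^ d) :
    ∃ z : Fin m → Feature d, (Pairwise fun i j => 6 * a < dist (z i) (z j)) ∧
      ∀ i, dist (z i) x₀ ≤ ρ := by
  have hd0 : (1 : ℝ) ≤ d := by exact_mod_cast hd
  have hm0 : (1 : ℝ) ≤ m := by exact_mod_cast hm
  set N := ⌊ρ / (7 * d * a)⌋₊ with hN
  have hda : 0 < 7 * (d : ℝ) * a := by positivity
  have hρa : 14 * d * a ≤ ρ := by
    have h1 : (14 * d * a) ^ d ≤ ρ ^ d := by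
      have : 0 ≤ (14 * (d : ℝ) * a) ^ d := by positivity
      nlinarith
    exact (pow_le_pow_iff_left₀ (by positivity) hρ.le (by omega)).mp h1
  have hNle : (N : ℝ) * (7 * d * a) ≤ ρ := by
    rw [← le_div_iff₀ hda]
    exact Nat.floor_le (by positivity)
  have hNge : ρ / (14 * d * a) ≤ N := by
    have h1 : ρ / (7 * d * a) < N + 1 := Nat.lt_floor_add_one _
    have h2 : ρ / (7 * d * a) = 2 * (ρ / (14 * d * a)) := by field_simp; norm_num
    have h3 : 1 ≤ ρ / (14 * d * a) := by rw [le_div_iff₀ (by positivity)]; linarith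
    linarith
  have hcard : m ≤ N ^ d := by
    have h1 : (m : ℝ) ≤ (ρ / (14 * d * a)) ^ d := by
      rw [div_pow, le_div_iff₀ (by positivity)]; exact hmρ
    have h2 : (m : ℝ) ≤ (N : ℝ) ^ d := h1.trans (pow_le_pow_left₀ (by positivity) hNge d)
    exact_mod_cast h2
  obtain ⟨e⟩ : Nonempty (Fin m ↪ (Fin d → Fin N)) :=
    Function.Embedding.nonempty_of_card_le (by simpa using hcard)
  let z : Fin m → Feature d := fun i => x₀ + WithLp.toLp 2 fun k => 7 * a * (e i k : ℝ)
  have hz : ∀ i k, z i k = x₀ k + 7 * a * (e i k : ℝ) := fun i k => rfl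
  refine ⟨z, fun i j hij => ?_, fun i => ?_⟩
  · obtain ⟨k, hk⟩ : ∃ k, e i k ≠ e j k :=
      Function.ne_iff.mp fun h => hij (e.injective h)
    have h1 : ‖(z i - z j) k‖ ≤ ‖z i - z j‖ := PiLp.norm_apply_le _ _
    have h2 : (z i - z j) k = 7 * a * ((e i k : ℝ) - e j k) := by
      rw [PiLp.sub_apply, hz, hz]; ring
    have h3 : (1 : ℝ) ≤ |(e i k : ℝ) - e j k| := by
      have : (1 : ℤ) ≤ |((e i k : ℕ) : ℤ) - (e j k : ℕ)| := by
        refine Int.one_le_abs (sub_ne_zero.mpr ?_)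
        exact_mod_cast fun h => hk (Fin.ext h)
      exact_mod_cast this
    rw [h2, Real.norm_eq_abs, abs_mul, abs_of_pos (by positivity)] at h1
    rw [dist_eq_norm]
    nlinarith
  · rw [dist_eq_norm]
    have h1 : ‖z i - x₀‖ ^ 2 ≤ (d * (7 * a * N)) ^ 2 := by
      rw [EuclideanSpace.norm_sq_eq]
      calc ∑ k, ‖(z i - x₀) k‖ ^ 2 ≤ ∑ _k : Fin d, (7 * a * N) ^ 2 := by
            refine Finset.sum_le_sum fun k _ => ?_
            have h2 : (z i - x₀) k = 7 * a * (e i k : ℝ) := by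
              rw [PiLp.sub_apply, hz]; ring
            rw [h2, Real.norm_eq_abs, abs_of_nonneg (by positivity)]
            have h3 : (e i k : ℝ) ≤ N := by exact_mod_cast (e i k).2.le
            gcongr
        _ = d * (7 * a * N) ^ 2 := by simp
        _ ≤ (d * (7 * a * N)) ^ 2 := by
            rw [mul_pow (d : ℝ)]
            have h3 : (d : ℝ) ≤ (d : ℝ) ^ 2 := by nlinarith
            exact mul_le_mul_of_nonneg_right h3 (sq_nonneg (7 * a * (N : ℝ)))
    have h2 : ‖z i - x₀‖ ≤ d * (7 * a * N) :=
      (pow_le_pow_iff_left₀ (norm_nonneg _) (by positivity) two_ne_zero).mp h1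
    linarith


/-! ### Hypercubes of distributions in the class -/

/-- The uniform distribution on `A`, given by its Lebesgue density. -/
noncomputable def uniformLaw {d : ℕ} (A : Set (Feature d)) : Measure (Feature d) :=
  volume.withDensity fun x => ENNReal.ofReal (A.indicator (fun _ => (volume.real A)⁻¹) x)

theorem uniformLaw_eq_smul {d : ℕ} {A : Set (Feature d)} (hA : MeasurableSet A) :
    uniformLaw A = ENNReal.ofReal (volume.real A)⁻¹ • volume.restrict A := by
  have h : (fun x => ENNReal.ofReal (A.indicator (fun _ => (volume.real A)⁻¹) x))
      = A.indicator fun _ => ENNReal.ofReal (volume.real A)⁻¹ := by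
    ext x
    by_cases hx : x ∈ A <;> simp [hx]
  rw [uniformLaw, h, withDensity_indicator hA, withDensity_const]

theorem uniformLaw_real_apply {d : ℕ} {A S : Set (Feature d)} (hA : MeasurableSet A)
    (hS : MeasurableSet S) :
    (uniformLaw A).real S = volume.real (S ∩ A) / volume.real A := by
  rw [uniformLaw_eq_smul hA, measureReal_ennreal_smul_apply, measureReal_restrict_apply hS,
    ENNReal.toReal_ofReal (inv_nonneg.mpr measureReal_nonneg), inv_mul_eq_div]

theorem isProbabilityMeasure_uniformLaw {d : ℕ} {A : Set (Feature d)} (hA : MeasurableSet A)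
    (hpos : 0 < volume.real A) : IsProbabilityMeasure (uniformLaw A) := by
  refine ⟨?_⟩
  have htop : volume A ≠ ⊤ := fun h => by simp [measureReal_def, h] at hpos
  rw [uniformLaw_eq_smul hA, Measure.smul_apply, Measure.restrict_apply_univ, smul_eq_mul,
    ← ofReal_measureReal htop, ← ENNReal.ofReal_mul (inv_nonneg.mpr hpos.le),
    inv_mul_cancel₀ hpos.ne', ENNReal.ofReal_one]

theorem ae_mem_uniformLaw {d : ℕ} {A : Set (Feature d)} (hA : MeasurableSet A) :
    ∀ᵐ x ∂(uniformLaw A), x ∈ A := by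
  rw [uniformLaw_eq_smul hA]
  exact Measure.ae_smul_measure (ae_restrict_mem hA) _

theorem strongDensity_uniformLaw {d : ℕ} {c₀ r₀ μmin μmax : ℝ} {K A : Set (Feature d)}
    (hA : IsCompact A) (hAK : A ⊆ K) (hreg : IsRegularSet c₀ r₀ A) (hpos : 0 < volume.real A)
    (hmin : μmin * volume.real A ≤ 1) (hmax : 1 ≤ μmax * volume.real A) :
    StrongDensity c₀ r₀ μmin μmax K (uniformLaw A) := by
  refine ⟨A, hA, hAK, hreg, A.indicator fun _ => (volume.real A)⁻¹,
    measurable_const.indicator hA.isClosed.measurableSet, rfl, fun x hx => ?_, fun x hx => ?_⟩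
  · rw [Set.indicator_of_mem hx]
    exact ⟨by rwa [← one_div, le_div_iff₀ hpos], by rwa [← one_div, div_le_iff₀ hpos]⟩
  · exact Set.indicator_of_notMem hx _

/-- If `η - 1/2` vanishes off a set of mass at most `C₀ h ^ α` and is `± h` on it, then the margin
assumption holds. -/
theorem margin_jointLaw {d : ℕ} {Q : Measure (Feature d)} [IsProbabilityMeasure Q]
    {η : Feature d → ℝ} {hη : Measurable η} [IsFiniteMeasure (jointLaw Q η hη)]
    (h0 : ∀ x, 0 ≤ η x) (h1 : ∀ x, η x ≤ 1) {U : Set (Feature d)} {C₀ α h : ℝ} (hα : 0 ≤ α)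
    (hC₀ : 0 ≤ C₀) (hh : 0 < h) (hU : Q.real U ≤ C₀ * h ^ α)
    (hon : ∀ x ∈ U, |η x - 1 / 2| = h) (hoff : ∀ᵐ x ∂Q, x ∉ U → η x = 1 / 2) :
    Margin C₀ α (jointLaw Q η hη) := by
  intro t ht
  have hrhs : 0 ≤ C₀ * t ^ α := mul_nonneg hC₀ (Real.rpow_nonneg ht.le α)
  rw [fst_jointLaw h0 h1]
  have hae : ∀ᵐ x ∂Q, (0 < |regression (jointLaw Q η hη) x - 1 / 2| ∧
      |regression (jointLaw Q η hη) x - 1 / 2| ≤ t) → x ∈ U ∧ h ≤ t := by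
    filter_upwards [regression_jointLaw (hη := hη) h0 h1, hoff] with x hx hx' hmem
    rw [← hx] at hmem
    by_cases hxU : x ∈ U
    · rw [hon x hxU] at hmem
      exact ⟨hxU, hmem.2⟩
    · rw [hx' hxU] at hmem
      simp at hmem
  rcases le_or_gt h t with hle | hlt
  · calc Q.real _ ≤ Q.real U := by
          refine ENNReal.toReal_mono (measure_ne_top Q U) (measure_mono_ae ?_)
          filter_upwards [hae] with x hx hmem
          exact (hx hmem).1
      _ ≤ C₀ * h ^ α := hU
      _ ≤ C₀ * t ^ α :=
        mul_le_mul_of_nonneg_left (Real.rpow_le_rpow hh.le hle hα) hC₀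
  · refine le_trans (le_of_eq ?_) hrhs
    rw [measureReal_def, measure_eq_zero_iff_ae_notMem.mpr, ENNReal.toReal_zero]
    filter_upwards [hae] with x hx hmem
    exact absurd (hx hmem).2 (not_le.mpr hlt)

/-- The sign encoded by a Boolean: `true` is `1` and `false` is `-1`. -/
def signValue (y : Bool) : ℝ := if y then 1 else -1

theorem abs_signValue (y : Bool) : |signValue y| = 1 := by
  cases y <;> simp [signValue]

set_option maxHeartbeats 1000000 in
/-- The lower bound at a fixed scale `a`: the marginal is uniform on `A` minus the shells around
the centres `z i`, and the regression function is `1/2 ± b a^β` on the enclosed balls and `1/2` on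
the remaining part of the support. -/
theorem worstExcessRisk_ge_of_scale {d : ℕ} {α β L C₀ c₀ c₁ r₀ s ε μmin μmax a b M : ℝ}
    {K A : Set (Feature d)} (hα : 0 < α) (hβ : 0 < β) (hC₀ : 0 < C₀) (hμmax : 0 < μmax)
    (hμmin : 0 < μmin)
    (hA : IsCompact A) (hAK : A ⊆ K) (hreg : IsRegularSet c₁ r₀ A) (hc : c₀ ≤ c₁)
    (hAmin : μmin * volume.real A ≤ 1)
    (hAmax : 1 ≤ μmax * ((2 - (1 + ε) ^ d) * volume.real A))
    (hs : 0 < s) (hs2 : s ≤ 1 / 2) (hhalf : c₀ ≤ (1 - s) ^ d / 2) (hε0 : 0 < ε) (hε1 : ε ≤ 1)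
    (hκ : ((1 + ε) ^ d - 1) * (1 + 3 / s) ^ d ≤ c₁ - c₀)
    {φ : Feature d → ℝ} (hφ : ContDiff ℝ (strictFloor β + 1) φ) (hφ1 : ∀ x, |φ x| ≤ 1)
    (hone : ∀ x, ‖x‖ ≤ 1 → φ x = 1) (hzero : ∀ x, 1 + ε ≤ ‖x‖ → φ x = 0)
    (hsupp : tsupport φ ⊆ Metric.closedBall 0 (1 + ε))
    (hM : ∀ k ≤ strictFloor β + 1, ∀ x, ‖iteratedFDeriv ℝ k φ x‖ ≤ M)
    (ha : 0 < a) (ha1 : a ≤ 1) (hb : 0 < b) (hb4 : b ≤ 1 / 4)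
    (hbL : b * ((strictFloor β + 2) * M) ≤ L)
    {m : ℕ} {z : Fin m → Feature d} (hsep : Pairwise fun i j => 6 * a < dist (z i) (z j))
    (hzA : ∀ i, Metric.closedBall (z i) (4 * a) ⊆ A)
    (hmargin : m * (volume.real (Metric.ball (0 : Feature d) 1) * a ^ d * μmax)
      ≤ C₀ * (b * a ^ β) ^ α)
    {n : ℕ} (hn : n * (22 * (b * a ^ β) ^ 2 *
      (volume.real (Metric.ball (0 : Feature d) 1) * a ^ d * μmax)) ≤ 1 / 2)
    {f : (Fin n → Obs d) → Feature d → Bool} (hf : IsClassifier f) :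
    m * (b * a ^ β *
        (volume.real (Metric.ball (0 : Feature d) 1) * a ^ d / volume.real A) / 2)
      ≤ worstExcessRisk (classPSigma d α β L C₀ c₀ r₀ μmin μmax K) f := by
  set v := volume.real (Metric.ball (0 : Feature d) 1) with hv
  have hv0 : 0 < v := volume_real_unitBall_pos d
  set h := b * a ^ β with hh
  have haβ : 0 < a ^ β := Real.rpow_pos_of_pos ha β
  have hh0 : 0 < h := mul_pos hb haβ
  have hh4 : h ≤ 1 / 4 := by
    exact (mul_le_of_le_one_right hb.le (Real.rpow_le_one ha.le ha1 hβ.le)).trans hb4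
  -- the support of the marginal
  set A' := A \ shells z a ε with hA'
  have hA'c : IsCompact A' := hA.diff (isOpen_shells z a ε)
  have hA'm : MeasurableSet A' := hA'c.isClosed.measurableSet
  have hAtop : volume A ≠ ⊤ := hA.measure_lt_top.ne
  have hreg' : IsRegularSet c₀ r₀ A' :=
    isRegularSet_diff_shells hA hreg hc hs hs2 hhalf hε0 hε1 hκ ha hsep hzA
  have hA'le : volume.real A' ≤ volume.real A := measureReal_mono Set.sdiff_subset hAtop
  have hA'ge : (2 - (1 + ε) ^ d) * volume.real A ≤ volume.real A' := by
    have h1 : volume.real (shells z a ε ∩ A) ≤ ((1 + ε) ^ d - 1) * volume.real A :=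
      volume_shells_inter_le ha hε0 (fun i j hij => by linarith [hsep hij]) hAtop
        fun i _ _ _ => (Metric.closedBall_subset_closedBall (by linarith)).trans (hzA i)
    have h2 := measureReal_sdiff_add_inter (μ := volume) (s := A)
      (isOpen_shells z a ε).measurableSet hAtop
    rw [Set.inter_comm] at h2
    linarith
  have hA'max : 1 ≤ μmax * volume.real A' :=
    hAmax.trans (mul_le_mul_of_nonneg_left hA'ge hμmax.le)
  have hA'pos : 0 < volume.real A' := by
    refine pos_of_mul_pos_right (one_pos.trans_le hA'max) hμmax.le
  have hA'min : μmin * volume.real A' ≤ 1 :=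
    (mul_le_mul_of_nonneg_left hA'le hμmin.le).trans hAmin
  set Q := uniformLaw A' with hQ
  have : IsProbabilityMeasure Q := isProbabilityMeasure_uniformLaw hA'm hA'pos
  -- the enclosed balls and their common mass
  set B : Fin m → Set (Feature d) := fun i => Metric.closedBall (z i) a with hB
  have hBm : ∀ i, MeasurableSet (B i) := fun i => Metric.isClosed_closedBall.measurableSet
  have hBdisj : Pairwise fun i j => Disjoint (B i) (B j) := fun i j hij =>
    Metric.closedBall_disjoint_closedBall (by linarith [hsep hij])
  have hBA' : ∀ i, B i ⊆ A' := by
    intro i x hx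
    have hxi : dist x (z i) ≤ a := hx
    refine ⟨hzA i (Metric.closedBall_subset_closedBall (by linarith) hx), fun hmem => ?_⟩
    obtain ⟨j, hj⟩ := Set.mem_iUnion.mp hmem
    have hj2 : dist x (z j) < (1 + ε) * a := hj.2
    by_cases hij : i = j
    · subst hij
      exact absurd hj.1 (not_lt.mpr hxi)
    · have h1 := hsep hij
      have h2 := dist_triangle_left (z i) (z j) x
      nlinarith
  set ω := v * a ^ d / volume.real A' with hω
  have hω0 : 0 < ω := by positivity
  have hBω : ∀ i, Q.real (B i) = ω := by
    intro i
    rw [hQ, uniformLaw_real_apply hA'm (hBm i), Set.inter_eq_left.mpr (hBA' i),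
      volume_real_closedBall _ ha.le, hω]
    ring
  have hωle : ω ≤ v * a ^ d * μmax := by
    rw [hω, div_le_iff₀ hA'pos, mul_assoc]
    exact le_mul_of_one_le_right (by positivity) hA'max
  have hωge : v * a ^ d / volume.real A ≤ ω :=
    div_le_div_of_nonneg_left (by positivity) hA'pos hA'le
  -- the regression functions
  set w : Fin m → Feature d := fun i => a⁻¹ • z i with hw
  have hdist : ∀ x i, dist (a⁻¹ • x) (w i) = dist x (z i) / a := by
    intro x i
    rw [hw, dist_smul₀, norm_inv, Real.norm_eq_abs, abs_of_pos ha, inv_mul_eq_div]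
  have hwsep : Pairwise fun i j => 2 * (1 + ε) < dist (w i) (w j) := by
    intro i j hij
    change 2 * (1 + ε) < dist (a⁻¹ • z i) (w j)
    rw [hdist, lt_div_iff₀ ha]
    have h3 : 2 * (1 + ε) * a ≤ 4 * a := mul_le_mul_of_nonneg_right (by linarith) ha.le
    linarith [hsep hij]
  set Φ : (Fin m → Bool) → Feature d → ℝ := fun σ => bumpSum φ w fun i => signValue (σ i) with hΦ
  have hΦs : ∀ σ, ContDiff ℝ (strictFloor β + 1) (Φ σ) := fun σ => contDiff_bumpSum hφ _ _
  have hΦM : ∀ σ, ∀ k ≤ strictFloor β + 1, ∀ x, ‖iteratedFDeriv ℝ k (Φ σ) x‖ ≤ M := by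
    intro σ k hk x
    exact norm_iteratedFDeriv_bumpSum_le (hφ.of_le (by exact_mod_cast hk)) hsupp (hM k hk) hwsep
      (fun i => (abs_signValue _).le) x
  have hΦ1 : ∀ σ x, |Φ σ x| ≤ 1 := by
    intro σ x
    have h1 := norm_iteratedFDeriv_bumpSum_le (k := 0) (M := 1) (s := fun i => signValue (σ i))
      (hφ.of_le (by simp)) hsupp
      (fun x => by rw [norm_iteratedFDeriv_zero]; exact hφ1 x) hwsep
      (fun i => (abs_signValue _).le) x
    rwa [norm_iteratedFDeriv_zero] at h1
  set η : (Fin m → Bool) → Feature d → ℝ := fun σ x => 1 / 2 + b * a ^ β * Φ σ (a⁻¹ • x) with hη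
  have hηm : ∀ σ, Measurable (η σ) := fun σ =>
    (continuous_const.add (continuous_const.mul
      ((hΦs σ).continuous.comp (continuous_const_smul _)))).measurable
  have hη0 : ∀ σ x, 1 / 4 ≤ η σ x := by
    intro σ x
    have h1 := (abs_le.mp (hΦ1 σ (a⁻¹ • x))).1
    have h2 := mul_le_mul_of_nonneg_left h1 hh0.le
    change _ ≤ 1 / 2 + h * Φ σ (a⁻¹ • x)
    linarith
  have hη1 : ∀ σ x, η σ x ≤ 3 / 4 := by
    intro σ x
    have h1 := (abs_le.mp (hΦ1 σ (a⁻¹ • x))).2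
    have h2 := mul_le_mul_of_nonneg_left h1 hh0.le
    change 1 / 2 + h * Φ σ (a⁻¹ • x) ≤ _
    linarith
  have u0 : ∀ σ x, 0 ≤ η σ x := fun σ x => by linarith [hη0 σ x]
  have u1 : ∀ σ x, η σ x ≤ 1 := fun σ x => by linarith [hη1 σ x]
  have hval : ∀ σ i, ∀ x ∈ B i, η σ x = 1 / 2 + if σ i then h else -h := by
    intro σ i x hx
    have h1 : Φ σ (a⁻¹ • x) = signValue (σ i) := by
      refine bumpSum_eq_of_dist_le (R := 1 + ε) hone hzero (by linarith) hwsep _ ?_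
      rw [hdist, div_le_one ha]
      exact hx
    simp only [hη, h1, ← hh, signValue]
    split_ifs <;> ring
  have hfar : ∀ x ∈ A', ∀ i, x ∉ B i → 1 + ε ≤ dist (a⁻¹ • x) (w i) := by
    intro x hx i hxi
    rw [hdist, le_div_iff₀ ha]
    by_contra hcon
    exact hx.2 (Set.mem_iUnion.mpr ⟨i, not_le.mp hxi, not_le.mp hcon⟩)
  have hoff : ∀ σ i, ∀ᵐ x ∂Q, x ∉ B i → η (flipAt i σ) x = η σ x := by
    intro σ i
    filter_upwards [ae_mem_uniformLaw hA'm] with x hx hxi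
    simp only [hη, hΦ, bumpSum]
    congr 2
    refine Finset.sum_congr rfl fun j _ => ?_
    by_cases hji : j = i
    · subst hji
      rw [hzero _ (by rw [← dist_eq_norm]; exact hfar x hx j hxi), mul_zero, mul_zero]
    · rw [flipAt, Function.update_of_ne hji]
  have hPs : ∀ σ, ∃ P ∈ classPSigma d α β L C₀ c₀ r₀ μmin μmax K,
      (P : Measure (Obs d)) = jointLaw Q (η σ) (hηm σ) := by
    intro σ
    have hprob : IsProbabilityMeasure (jointLaw Q (η σ) (hηm σ)) :=
      isProbabilityMeasure_jointLaw (u0 σ) (u1 σ)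
    have hfst : (jointLaw Q (η σ) (hηm σ)).fst = Q := fst_jointLaw (u0 σ) (u1 σ)
    refine ⟨⟨jointLaw Q (η σ) (hηm σ), hprob⟩, ⟨?_, ⟨η σ, fun x => ⟨u0 σ x, u1 σ x⟩, ?_, ?_⟩, ?_⟩,
      rfl⟩
    · refine margin_jointLaw (U := ⋃ i, B i) (h := h) (u0 σ) (u1 σ) hα.le hC₀.le hh0 ?_ ?_ ?_
      · calc Q.real (⋃ i, B i) ≤ ∑ i, Q.real (B i) := measureReal_iUnion_fintype_le _
          _ = m * ω := by simp [hBω]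
          _ ≤ m * (v * a ^ d * μmax) := mul_le_mul_of_nonneg_left hωle (Nat.cast_nonneg m)
          _ ≤ _ := hmargin
      · intro x hx
        obtain ⟨i, hi⟩ := Set.mem_iUnion.mp hx
        rw [hval σ i x hi]
        split_ifs <;> simp [abs_of_pos hh0]
      · filter_upwards [ae_mem_uniformLaw hA'm] with x hx hxU
        have h1 : Φ σ (a⁻¹ • x) = 0 := bumpSum_eq_zero hzero _ fun i =>
          hfar x hx i fun hi => hxU (Set.mem_iUnion.mpr ⟨i, hi⟩)
        simp [hη, h1]
    · change η σ =ᵐ[(jointLaw Q (η σ) (hηm σ)).fst] regression (jointLaw Q (η σ) (hηm σ))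
      rw [hfst]
      exact regression_jointLaw (u0 σ) (u1 σ)
    · exact rescale_mem_holderClass hβ ha hb.le (hΦs σ) (hΦM σ) hbL
    · change StrongDensity c₀ r₀ μmin μmax K (jointLaw Q (η σ) (hηm σ)).fst
      rw [hfst]
      exact strongDensity_uniformLaw hA'c (Set.sdiff_subset.trans hAK) hreg' hA'pos hA'min hA'max
  have hmain := card_mul_le_worstExcessRisk (Q := Q) hηm hη0 hη1 hBm hBdisj hh0 hh4 hω0 hBω hval
    hoff (n := n) ?_ hPs hf
  · rw [Fintype.card_fin] at hmain
    refine le_trans (mul_le_mul_of_nonneg_left ?_ (Nat.cast_nonneg m)) hmain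
    have := mul_le_mul_of_nonneg_left hωge hh0.le
    linarith
  · refine le_trans (mul_le_mul_of_nonneg_left ?_ (Nat.cast_nonneg n)) hn
    exact mul_le_mul_of_nonneg_left hωle (by positivity)


/-! ### Choice of the parameters -/

open Filter Topology in
/-- A constant `c₀ < 1/2` leaves room for caps that are slightly less than half-balls. -/
theorem exists_cap_parameter (d : ℕ) {c₀ : ℝ} (hc : c₀ < 1 / 2) :
    ∃ s : ℝ, 0 < s ∧ s ≤ 1 / 2 ∧ c₀ ≤ (1 - s) ^ d / 2 := by
  have hcont : Tendsto (fun s : ℝ => (1 - s) ^ d / 2) (𝓝[>] 0) (𝓝 (1 / 2)) := by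
    have : Continuous fun s : ℝ => (1 - s) ^ d / 2 := by fun_prop
    simpa using (this.tendsto 0).mono_left nhdsWithin_le_nhds
  have h2 : Set.Ioc (0 : ℝ) (1 / 2) ∈ 𝓝[>] (0 : ℝ) := Ioc_mem_nhdsGT (by norm_num)
  obtain ⟨s, hs, hs'⟩ := ((hcont.eventually_const_lt hc).and h2).exists
  exact ⟨s, hs'.1, hs'.2, hs.le⟩

open Filter Topology in
/-- Shells of small relative width `ε` remove little volume. -/
theorem exists_shell_width (d : ℕ) {c δ μ V : ℝ} (hδ : 0 < δ) (hV : 1 < μ * V) :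
    ∃ ε : ℝ, 0 < ε ∧ ε ≤ 1 ∧ ((1 + ε) ^ d - 1) * c ≤ δ ∧ 1 ≤ μ * ((2 - (1 + ε) ^ d) * V) := by
  have h1 : Tendsto (fun ε : ℝ => ((1 + ε) ^ d - 1) * c) (𝓝[>] 0) (𝓝 0) := by
    have : Continuous fun ε : ℝ => ((1 + ε) ^ d - 1) * c := by fun_prop
    simpa using (this.tendsto 0).mono_left nhdsWithin_le_nhds
  have h2 : Tendsto (fun ε : ℝ => μ * ((2 - (1 + ε) ^ d) * V)) (𝓝[>] 0) (𝓝 (μ * V)) := by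
    have : Continuous fun ε : ℝ => μ * ((2 - (1 + ε) ^ d) * V) := by fun_prop
    have h := (this.tendsto 0).mono_left (nhdsWithin_le_nhds (s := Set.Ioi 0))
    convert h using 2
    norm_num
  have h3 : Set.Ioc (0 : ℝ) 1 ∈ 𝓝[>] (0 : ℝ) := Ioc_mem_nhdsGT one_pos
  obtain ⟨ε, ⟨e1, e2⟩, e3⟩ :=
    (((h1.eventually_lt_const hδ).and (h2.eventually_const_lt hV)).and h3).exists
  exact ⟨ε, e3.1, e3.2, e1.le, e2.le⟩

open Filter Topology in
/-- All smallness requirements on the scale hold below some threshold `a₁`. -/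
theorem exists_scale_threshold {ρ κ c₁ c₂ γ p q δ : ℝ} (hρ : 0 < ρ) (hp : 0 < p) (hq : 0 < q)
    (hδ : 0 < δ) (hκ : 0 < κ) (hγ : 0 < γ ∨ γ = 0 ∧ 1 ≤ κ) :
    ∃ a₁ : ℝ, 0 < a₁ ∧ ∀ a, 0 < a → a ≤ a₁ →
      a ≤ 1 ∧ 4 * a ≤ ρ ∧ a ^ γ ≤ κ ∧ c₁ * a ^ p ≤ δ ∧ c₂ * a ^ q ≤ 1 / 2 := by
  have hlim : ∀ (c : ℝ) {r : ℝ}, 0 < r → Tendsto (fun a : ℝ => c * a ^ r) (𝓝[>] 0) (𝓝 0) := by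
    intro c r hr
    have h := ((Real.continuousAt_rpow_const 0 r (Or.inr hr.le)).tendsto.const_mul c).mono_left
      (nhdsWithin_le_nhds (s := Set.Ioi 0))
    simpa [Real.zero_rpow hr.ne'] using h
  have e1 : Set.Ioc (0 : ℝ) (min 1 (ρ / 4)) ∈ 𝓝[>] (0 : ℝ) := Ioc_mem_nhdsGT (by positivity)
  have e2 : ∀ᶠ a : ℝ in 𝓝[>] 0, a ^ γ ≤ κ := by
    rcases hγ with hγ | ⟨hγ, hκ1⟩
    · filter_upwards [(hlim 1 hγ).eventually_lt_const hκ] with a ha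
      linarith
    · exact Eventually.of_forall fun a => by rw [hγ, Real.rpow_zero]; exact hκ1
  have e3 := (hlim c₁ hp).eventually_lt_const hδ
  have e4 := (hlim c₂ hq).eventually_lt_const (show (0 : ℝ) < 1 / 2 by norm_num)
  have hall : {a : ℝ | a ≤ 1 ∧ 4 * a ≤ ρ ∧ a ^ γ ≤ κ ∧ c₁ * a ^ p ≤ δ ∧ c₂ * a ^ q ≤ 1 / 2}
      ∈ 𝓝[>] (0 : ℝ) := by
    filter_upwards [e1, e2, e3, e4] with a h1 h2 h3 h4
    have h5 := h1.2.trans (min_le_left _ _)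
    have h6 := h1.2.trans (min_le_right _ _)
    exact ⟨h5, by linarith, h2, h3.le, h4.le⟩
  obtain ⟨a₁, ha₁, hsub⟩ := mem_nhdsGT_iff_exists_Ioc_subset.mp hall
  exact ⟨a₁, ha₁, fun a h0 h1 => hsub ⟨h0, h1⟩⟩

end FastRates

theorem mainTheorem2 (d : ℕ) (hd : 1 ≤ d) (L β α : ℝ) (hL : 0 < L) (hβ : 0 < β) (hα : 0 < α)
    (hαβ : α * β ≤ d)
    (c₀ r₀ μmin μmax : ℝ) (hc₀ : 0 < c₀) (hr₀ : 0 < r₀) (hμmin : 0 < μmin) (hμ : μmin < μmax)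
    (K : Set (FastRates.Feature d)) (hK : IsCompact K)
    (hnd : FastRates.NonDegenerate c₀ r₀ μmin μmax K) :
    ∃ Cstar : ℝ, 0 ≤ Cstar ∧ (α * β < d → Cstar = 0) ∧
      ∀ C₀ : ℝ, Cstar < C₀ →
        ∃ C : ℝ, 0 < C ∧
          ∀ n : ℕ, 1 ≤ n →
            ∀ f : (Fin n → FastRates.Obs d) → FastRates.Feature d → Bool,
              FastRates.IsClassifier f →
                C * (n : ℝ) ^ (-(β * (1 + α) / (2 * β + d))) ≤
                  FastRates.worstExcessRisk
                    (FastRates.classPSigma d α β L C₀ c₀ r₀ μmin μmax K) f := by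
  obtain ⟨A, hA, hAK, hint, ⟨c₁, hc₁, hreg⟩, hAmin, hAmax⟩ := hnd
  have hμmax : 0 < μmax := hμmin.trans hμ
  have hAne : A.Nonempty := hint.mono interior_subset
  have hhalf : c₀ < 1 / 2 :=
    hc₁.trans_le (FastRates.regular_const_le_half hd hA hAne hr₀ hreg)
  obtain ⟨x₀, hx₀⟩ := hint
  obtain ⟨ρ', hρ', hball⟩ := Metric.isOpen_iff.mp isOpen_interior x₀ hx₀
  obtain ⟨ρ, hρ, hρρ'⟩ : ∃ ρ, 0 < ρ ∧ 2 * ρ < ρ' := ⟨ρ' / 3, by positivity, by linarith⟩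
  obtain ⟨s, hs, hs2, hcap⟩ := FastRates.exists_cap_parameter d hhalf
  obtain ⟨ε, hε0, hε1, hκ, hvol⟩ := FastRates.exists_shell_width d (c := (1 + 3 / s) ^ d)
    (sub_pos.mpr hc₁) hAmax
  -- the bump profile and the height `b` allowed by the Hölder constant
  let φ : ContDiffBump (0 : FastRates.Feature d) :=
    { rIn := 1, rOut := 1 + ε, rIn_pos := one_pos, rIn_lt_rOut := by linarith }
  set l := FastRates.strictFloor β with hl
  have hφs : ContDiff ℝ ((l + 1 : ℕ) : WithTop ℕ∞) φ := φ.contDiff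
  obtain ⟨M, hM0, hM⟩ := FastRates.exists_bound_iteratedFDeriv hφs φ.hasCompactSupport
  have hlM : 0 < ((l : ℝ) + 2) * M := by positivity
  obtain ⟨b, hb, hb4, hbL⟩ : ∃ b, 0 < b ∧ b ≤ 1 / 4 ∧ b * ((l + 2) * M) ≤ L :=
    ⟨min (1 / 4) (L / ((l + 2) * M)), by positivity, min_le_left _ _,
      (le_div_iff₀ hlM).mp (min_le_right _ _)⟩
  set v := volume.real (Metric.ball (0 : FastRates.Feature d) 1) with hv
  have hv0 : 0 < v := FastRates.volume_real_unitBall_pos d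
  have hbα : 0 < b ^ α := Real.rpow_pos_of_pos hb α
  have hthr : 0 ≤ v * μmax / b ^ α := by positivity
  -- if `α β = d`, a single bump at scale `a` has mass at most `v a^d μmax`, and the margin
  -- assumption compares this with `C₀ (b a^β)^α = C₀ b^α a^d`
  refine ⟨if α * β < d then 0 else v * μmax / b ^ α, by split_ifs <;> simp [hthr],
    fun h => if_pos h, fun C₀ hC₀' => ?_⟩
  have hC₀ : 0 < C₀ := lt_of_le_of_lt (by split_ifs <;> simp [hthr]) hC₀'
  set κ := min 1 (C₀ * b ^ α / (v * μmax)) with hκdef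
  have hκ0 : 0 < κ := by positivity
  have hκ1 : κ ≤ 1 := min_le_left _ _
  have hκC : κ * (v * μmax) ≤ C₀ * b ^ α :=
    (le_div_iff₀ (by positivity)).mp (min_le_right _ _)
  have hγ : 0 < (d : ℝ) - α * β ∨ (d : ℝ) - α * β = 0 ∧ 1 ≤ κ := by
    rcases hαβ.lt_or_eq with h | h
    · exact Or.inl (sub_pos.mpr h)
    · refine Or.inr ⟨by rw [h, sub_self], le_min le_rfl ?_⟩
      rw [if_neg (by rw [h]; exact lt_irrefl _), div_lt_iff₀ hbα] at hC₀'
      rw [le_div_iff₀ (by positivity)]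
      linarith
  have hd0 : (0 : ℝ) < d := by exact_mod_cast hd
  obtain ⟨a₁, ha₁, hsmall⟩ := FastRates.exists_scale_threshold (ρ := ρ) (κ := κ)
    (c₁ := (14 * d) ^ d) (c₂ := 22 * b ^ 2 * (v * μmax)) (γ := d - α * β) (p := α * β)
    (q := 2 * β + d) (δ := ρ ^ d) hρ (by positivity) (by positivity) (by positivity) hκ0 hγ
  have hVA : 0 < volume.real A := pos_of_mul_pos_right (one_pos.trans hAmax) hμmax.le
  refine ⟨κ / 2 * (b * (v / volume.real A) / 2) * a₁ ^ (β * (1 + α)), by positivity,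
    fun n hn f hf => ?_⟩
  have hn1 : (1 : ℝ) ≤ n := by exact_mod_cast hn
  have hn0 : (0 : ℝ) < n := by linarith
  -- the scale at which the sign of a bump is just undetectable from `n` observations
  set t : ℝ := (n : ℝ) ^ (-(1 / (2 * β + d))) with ht
  have ht0 : 0 < t := Real.rpow_pos_of_pos hn0 _
  have ht1 : t ≤ 1 := Real.rpow_le_one_of_one_le_of_nonpos hn1 (by
    rw [neg_nonpos]; positivity)
  set a := a₁ * t with ha
  have ha0 : 0 < a := by positivity
  obtain ⟨ha1, ha4, haκ, haρ, -⟩ := hsmall a ha0 (mul_le_of_le_one_right ha₁.le ht1)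
  have hq := (hsmall a₁ ha₁ le_rfl).2.2.2.2
  have haq : n * a ^ (2 * β + d) = a₁ ^ (2 * β + d) := by
    have hne : 2 * β + d ≠ 0 := by positivity
    rw [ha, Real.mul_rpow ha₁.le ht0.le, ht, ← Real.rpow_mul hn0.le, neg_mul,
      one_div_mul_cancel hne, Real.rpow_neg_one]
    field_simp
  have had : a ^ (α * β - d) * a ^ d = a ^ (α * β) := by
    rw [← Real.rpow_natCast, ← Real.rpow_add ha0, sub_add_cancel]
  have hκa : 1 ≤ κ * a ^ (α * β - d) := by
    rw [← neg_sub, Real.rpow_neg ha0.le, ← div_eq_mul_inv,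
      le_div_iff₀ (Real.rpow_pos_of_pos ha0 _), one_mul]
    exact haκ
  set m := ⌊κ * a ^ (α * β - d)⌋₊ with hm
  have hm1 : 1 ≤ m := Nat.le_floor (by exact_mod_cast hκa)
  have hmle : (m : ℝ) ≤ κ * a ^ (α * β - d) := Nat.floor_le (by positivity)
  have hmge : κ * a ^ (α * β - d) / 2 ≤ m := by
    have h1 : κ * a ^ (α * β - d) < m + 1 := Nat.lt_floor_add_one _
    have h2 : (1 : ℝ) ≤ m := by exact_mod_cast hm1
    linarith
  have hmρ : m * (14 * d * a) ^ d ≤ ρ ^ d := by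
    calc m * (14 * d * a) ^ d ≤ 1 * a ^ (α * β - d) * (14 * d * a) ^ d := by
          refine mul_le_mul_of_nonneg_right (hmle.trans ?_) (by positivity)
          exact mul_le_mul_of_nonneg_right hκ1 (Real.rpow_nonneg ha0.le _)
      _ = (14 * d) ^ d * (a ^ (α * β - d) * a ^ d) := by rw [mul_pow _ a]; ring
      _ ≤ ρ ^ d := by rw [had]; exact haρ
  obtain ⟨z, hsep, hz⟩ := FastRates.exists_separated_points hd x₀ ha0 hρ hm1 hmρ
  have hzA : ∀ i, Metric.closedBall (z i) (4 * a) ⊆ A := fun i =>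
    (Metric.closedBall_subset_ball' (by linarith [hz i])).trans (hball.trans interior_subset)
  have hpow2 : (a ^ β) ^ 2 * a ^ d = a ^ (2 * β + d) := by
    rw [← Real.rpow_natCast (a ^ β), ← Real.rpow_mul ha0.le, ← Real.rpow_natCast a,
      ← Real.rpow_add ha0]
    congr 1
    push_cast
    ring
  have hbase := FastRates.worstExcessRisk_ge_of_scale (α := α) (β := β) (L := L) (C₀ := C₀)
    (r₀ := r₀) (M := M) (b := b) (φ := φ) (n := n) hα hβ hC₀ hμmax hμmin hA hAK hreg hc₁.le hAmin
    hvol hs hs2 hcap hε0 hε1 hκ (by exact_mod_cast hφs)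
    (fun x => by rw [abs_of_nonneg φ.nonneg]; exact φ.le_one)
    (fun x hx => φ.one_of_mem_closedBall (by simpa using hx))
    (fun x hx => φ.zero_of_le_dist (by simpa using hx))
    φ.tsupport_eq.le hM ha0 ha1 hb hb4 hbL hsep hzA ?_ ?_ hf
  · refine le_trans ?_ hbase
    have htn : (n : ℝ) ^ (-(β * (1 + α) / (2 * β + d))) = t ^ (β * (1 + α)) := by
      rw [ht, ← Real.rpow_mul hn0.le]
      congr 1
      ring
    have hexp : a ^ (α * β - d) * a ^ d * a ^ β = a ^ (β * (1 + α)) := by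
      rw [had, ← Real.rpow_add ha0]
      congr 1
      ring
    calc κ / 2 * (b * (v / volume.real A) / 2) * a₁ ^ (β * (1 + α))
          * (n : ℝ) ^ (-(β * (1 + α) / (2 * β + d)))
        = κ / 2 * (b * (v / volume.real A) / 2) * a ^ (β * (1 + α)) := by
          rw [htn, ha, Real.mul_rpow ha₁.le ht0.le]; ring
      _ = κ * a ^ (α * β - d) / 2 * (b * a ^ β * (v * a ^ d / volume.real A) / 2) := by
          rw [← hexp]; ring
      _ ≤ m * (b * a ^ β * (v * a ^ d / volume.real A) / 2) :=
          mul_le_mul_of_nonneg_right hmge (by positivity)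
  · calc m * (v * a ^ d * μmax) ≤ κ * a ^ (α * β - d) * (v * a ^ d * μmax) :=
          mul_le_mul_of_nonneg_right hmle (by positivity)
      _ = κ * (v * μmax) * a ^ (α * β) := by rw [← had]; ring
      _ ≤ C₀ * b ^ α * a ^ (α * β) :=
          mul_le_mul_of_nonneg_right hκC (Real.rpow_nonneg ha0.le _)
      _ = C₀ * (b * a ^ β) ^ α := by
          rw [Real.mul_rpow hb.le (Real.rpow_nonneg ha0.le _), ← Real.rpow_mul ha0.le,
            mul_comm β α, mul_assoc]
  · calc n * (22 * (b * a ^ β) ^ 2 * (v * a ^ d * μmax))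
        = 22 * b ^ 2 * (v * μmax) * (n * ((a ^ β) ^ 2 * a ^ d)) := by ring
      _ ≤ 1 / 2 := by rw [hpow2, haq]; exact hq
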